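/- **Proposition 1.4 (Pohozaev identity).** Fix $h\ge 0$ with $h\neq 1$, put $k=\min\{h,1\}$ and, for $m=(m_1,m_2)\in\mathbb S^1\subset\mathbb R^2$, let $$W(m)=\tfrac12\left(m_1^2-2hm_1+2hk-k^2\right)\ge 0 .$$ Let $\mathbb R^2_+=\mathbb R\times(0,\infty)$ and let $\dot H^1(\mathbb R^2_+)$ be the completion of $C_0^\infty(\overline{\mathbb R^2_+})$ with respect to the inner product $\int_{\mathbb R^2_+}\nabla\phi\cdot\nabla\psi\,dx$. For $m\in H^1_{\mathrm{loc}}(\mathbb R;\mathbb S^1)$ define $$E_h(m)=\frac12\int_{\mathbb R}\left(|m'|^2+2W(m)\right)dx_1+\frac12\int_{\mathbb R^2_+}|\nabla u|^2\,dx\in[0,\infty],$$ where $u\in\dot H^1(\mathbb R^2_+)$ is the unique solution of $$\int_{\mathbb R^2_+}\nabla u\cdot\nabla\zeta\,dx=\int_{\mathbb R}m_1'\,\zeta(\cdot,0)\,dx_1\quad\text{for all }\zeta\in C_0^\infty(\mathbb R^2),$$ which exists whenever $m_1-k\in H^1(\mathbb R)$, in particular whenever $\int_{\mathbb R}(|m'|^2+2W(m))\,dx_1<\infty$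 (if there is no solution, set $E_h(m)=\infty$). Call a map $m=(\cos\phi,\sin\phi)\in H^1_{\mathrm{loc}}(\mathbb R;\mathbb S^1)$ with $E_h(m)<\infty$ a critical point of $E_h$ if $$\left.\frac{d}{dt}\right|_{t=0}E_h\big(\cos(\phi+t\zeta),\sin(\phi+t\zeta)\big)=0\quad\text{for every }\zeta\in C_0^\infty(\mathbb R).$$ Let $m\in H^1_{\mathrm{loc}}(\mathbb R;\mathbb S^1)$ be a critical point of $E_h$ with $E_h(m)<\infty$. Then $|m'|^2$ and $W(m)$ are integrable on $\mathbb R$ and $$\int_{\mathbb R}|m'|^2\,dx_1=2\int_{\mathbb R}W(m)\,dx_1 .$$ -/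

import Mathlib

open scoped ContDiff

noncomputable section

namespace NeelWall

open MeasureTheory

/-- Real-valued test functions: smooth with compact support. -/
def IsTest {E : Type*} [NormedAddCommGroup E] [NormedSpace ℝ E] (ζ : E → ℝ) : Prop :=
  ContDiff ℝ ∞ ζ ∧ HasCompactSupport ζ

/-- `g` is a weak derivative of `f` on the real line. -/
def IsWeakDeriv (f g : ℝ → ℂ) : Prop :=
  LocallyIntegrable f ∧ LocallyIntegrable g ∧
    ∀ ζ : ℝ → ℝ, IsTest ζ → ∫ x, deriv ζ x • f x = -∫ x, ζ x • g x

/-- The space `H¹_loc(ℝ; 𝕊¹)`; the circle is the unit circle of `ℂ = ℝ²`, and functions stand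
for their almost-everywhere classes. The function itself is locally square-integrable because
it is bounded. -/
def MemH1loc (m : ℝ → Circle) : Prop :=
  ∃ g : ℝ → ℂ, IsWeakDeriv (fun x => (m x : ℂ)) g ∧
    ∀ K : Set ℝ, IsCompact K → MemLp g 2 (volume.restrict K)

open Classical in
/-- The weak derivative `m'` (unique almost everywhere), or `0` if there is none. -/
def weakDeriv (m : ℝ → Circle) : ℝ → ℂ :=
  if hm : ∃ g : ℝ → ℂ, IsWeakDeriv (fun x => (m x : ℂ)) g then hm.choose else 0

/-- The anisotropy potential `W(m) = (m₁² - 2 h m₁ + 2 h k - k²) / 2` with `k = min {h, 1}`. -/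
def anisotropy (h : ℝ) (z : Circle) : ℝ :=
  (1 / 2) * ((z : ℂ).re ^ 2 - 2 * h * (z : ℂ).re + 2 * h * min h 1 - (min h 1) ^ 2)

/-- The open half-plane `ℝ × (0, ∞)`. -/
def halfPlane : Set (ℝ × ℝ) := {x | 0 < x.2}

/-- The gradient of a function on the plane, as a vector of the Euclidean plane. -/
def grad (ζ : ℝ × ℝ → ℝ) (x : ℝ × ℝ) : EuclideanSpace ℝ (Fin 2) :=
  !₂[fderiv ℝ ζ x (1, 0), fderiv ℝ ζ x (0, 1)]

/-- Square-integrable vector fields on the half-plane. -/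
abbrev L2Field : Type :=
  Lp (EuclideanSpace ℝ (Fin 2)) 2 (volume.restrict halfPlane)

/-- The completion of the smooth compactly supported functions on the closed half-plane with
respect to `⟨φ, ψ⟩ = ∫ ∇φ · ∇ψ`. The map `φ ↦ ∇φ` is an isometry into the complete space of
square-integrable vector fields, so the completion is the closure of its image: an element `u`
is represented by its gradient `∇u` (this identifies potentials differing by a constant). -/
def HDotOne : Set L2Field :=
  closure {G | ∃ ζ : ℝ × ℝ → ℝ, IsTest ζ ∧ G =ᵐ[volume.restrict halfPlane] grad ζ}

/-- `G = ∇u` for the stray field potential `u` of `m`: the weak solution in `HDotOne` of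
`Δu = 0` in the half-plane with `∂u/∂x₂ = -m₁'` on its boundary. -/
def IsStrayField (m : ℝ → Circle) (G : L2Field) : Prop :=
  G ∈ HDotOne ∧
    ∀ ζ : ℝ × ℝ → ℝ, IsTest ζ →
      ∫ x in halfPlane, inner ℝ (G x) (grad ζ x) = ∫ s, (weakDeriv m s).re * ζ (s, 0)

/-- The Dirichlet integral `∫ |∇u|²` of the stray field potential, which is unique; it is `∞`
if there is no such potential. -/
def strayDirichlet (m : ℝ → Circle) : ENNReal :=
  ⨅ (G : L2Field) (_ : IsStrayField m G), ∫⁻ x in halfPlane, ‖G x‖ₑ ^ 2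

/-- The energy `E_h(m) = ½ ∫ (|m'|² + 2 W(m)) + ½ ∫ |∇u|²`, with values in `[0, ∞]`. -/
def energy (h : ℝ) (m : ℝ → Circle) : ENNReal :=
  (1 / 2) * (∫⁻ x, ENNReal.ofReal (‖weakDeriv m x‖ ^ 2 + 2 * anisotropy h (m x))) +
    (1 / 2) * strayDirichlet m

/-- `m` is a critical point of `E_h`: for every test function `ζ`, the derivative at `t = 0` of
the energy of the variation with phase `φ + t ζ`, where `m = e^{iφ}`, is zero. (When `m` is in
`H¹_loc` and has finite energy, so do all the variations.) -/
def IsCritical (h : ℝ) (m : ℝ → Circle) : Prop :=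
  ∀ ζ : ℝ → ℝ, IsTest ζ →
    HasDerivAt (fun t : ℝ => (energy h (fun x => Circle.exp (t * ζ x) * m x)).toReal) 0 0

end NeelWall

end

/-!
The identity expresses that the energy is stationary under dilations `x ↦ x + s x` of the line. Of
its three terms, `½ ∫ |m'|²` scales like `(1 + s)⁻¹`, `∫ W(m)` like `1 + s`, and the stray field
energy is invariant, since dilations of the half-plane are conformal; hence
`½ ∫ |m'|² = ∫ W(m)`. Two things have to be made rigorous. Dilations are not compactly
supported variations, and criticality only concerns variations of the phase by smooth functions,
whereas for `m` merely of finite energy an inner variation `m ∘ θ` need not be differentiable in `s`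
as a curve of phases.

Cut-off. Dilations are replaced by `Ψ = id + s X` with `X(x) = χ(κ x²) x`, extended to
`z ↦ z + s χ(κ |z|²) z` on the half-plane (`deform`). This map is conformal for `κ |z|² < 1`, and its
distortion elsewhere is `1 + O(s)` uniformly in `κ`, so the stray field energy of `m ∘ Ψ⁻¹` grows by
at most `C |s|` times the part of `∫ |∇u|²` over `κ |z|² ≥ 1` (`IsNeumann.norm_sq_le_of_deform`).
This bound uses only that the stray field energy is the squared norm of the functional `ζ ↦ ∫ m₁' ζ`
on gradients. The other two terms are computed by changing variables.

Criticality. Write `m = e^{iφ}` (`exists_phase`) and `θ = Ψ⁻¹`. Then `φ ∘ θ = φ + ψ` with `ψ` in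
`H¹` and compactly supported. The energy has an expansion at `φ` (`IsConfig.expansion`) whose linear
term vanishes, by criticality and density (`IsConfig.firstVariation_eq_zero`). For `φ' ∈ L²` one has
`|ψ|² = O(s)` and `∫ ψ² = O(s²)` (`IsDiffeo.variation_bounds`), but no rate for `∫ ψ'²`.
However, `½ ∫ ψ'²` occurs in the expansion with a positive sign and absorbs the only error term
containing `ψ'`, by means of the interpolation inequality `IsNeumann.norm_sq_le`. Therefore
`E(m ∘ θ) ≥ E(m) - o(s)`, and no regularity of `m` is needed.

Comparing both bounds for `s` of either sign gives
`|½ ∫ |m'|² X' - ∫ W(m) X'| ≤ C ∫_{κ |z|² ≥ 1} |∇u|²` (`IsConfig.abs_defect_le`), and the identity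
follows in the limit `κ → 0` by dominated convergence.
-/

open scoped ContDiff Convolution

noncomputable section

namespace NeelWall

open MeasureTheory Set Filter Topology

/-! ### Primitives of locally integrable functions and phases of circle-valued maps -/

/-- `f` is a primitive of the locally integrable function `p` on the real line; equivalently, `f`
is locally absolutely continuous with derivative `p` almost everywhere. -/
def IsPrimitive (f p : ℝ → ℝ) : Prop :=
  LocallyIntegrable p ∧ ∀ a b, ∫ x in a..b, p x = f b - f a

theorem _root_.MeasureTheory.LocallyIntegrable.toIntervalIntegrable {p : ℝ → ℝ}
    (hp : LocallyIntegrable p) (a b : ℝ) : IntervalIntegrable p volume a b :=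
  intervalIntegrable_iff.mpr <|
    (hp.integrableOn_isCompact isCompact_uIcc).mono_set uIoc_subset_uIcc

theorem exists_abs_bound_of_hasCompactSupport {f : ℝ → ℝ} (hs : HasCompactSupport f) :
    ∃ A, 0 ≤ A ∧ ∀ x, A < |x| → f x = 0 := by
  obtain ⟨A, hA⟩ := hs.isCompact.isBounded.subset_closedBall 0
  refine ⟨|A|, abs_nonneg A, fun x hx => ?_⟩
  by_contra hne
  have := hA (subset_tsupport f hne)
  rw [mem_closedBall_zero_iff, Real.norm_eq_abs] at this
  linarith [le_abs_self A]

theorem hasCompactSupport_of_abs_bound {f : ℝ → ℝ} {A : ℝ} (h : ∀ x, A < |x| → f x = 0) :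
    HasCompactSupport f :=
  HasCompactSupport.intro (isCompact_Icc (a := -A) (b := A)) fun x hx => h x <| by
    by_contra hle
    exact hx (abs_le.1 (not_lt.1 hle))

/-- A test function of integral zero is the derivative of a test function. -/
theorem exists_isTest_deriv_eq {u : ℝ → ℝ} (hu : ContDiff ℝ ∞ u) {A : ℝ} (hA : 0 ≤ A)
    (h0 : ∀ x, A < |x| → u x = 0) (hint : ∫ x, u x = 0) :
    ∃ v, IsTest v ∧ deriv v = u ∧ ∀ x, A < |x| → v x = 0 := by
  set v : ℝ → ℝ := fun x => ∫ t in (-A)..x, u t with hv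
  have hii : ∀ a b, IntervalIntegrable u volume a b := hu.continuous.intervalIntegrable
  have hd : ∀ x, HasDerivAt v (u x) x := fun x =>
    intervalIntegral.integral_hasDerivAt_right (hii _ _)
      (hu.continuous.stronglyMeasurableAtFilter _ _) hu.continuous.continuousAt
  have hdv : deriv v = u := funext fun x => (hd x).deriv
  have hvA : ∀ x, A < |x| → v x = 0 := by
    intro x hx
    rcases lt_abs.1 hx with h | h
    · rw [hv]
      simp only
      rw [intervalIntegral.integral_of_le (by linarith), ← hint]
      apply setIntegral_eq_integral_of_ae_compl_eq_zero
      filter_upwards [measure_eq_zero_iff_ae_notMem.1 (measure_singleton (μ := volume) (-A))]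
        with t htA ht
      apply h0
      by_contra hle
      have h1 := abs_le.1 (not_lt.1 hle)
      exact ht ⟨lt_of_le_of_ne h1.1 (fun h => htA (by simp [h])), by linarith⟩
    · rw [hv]
      simp only
      rw [intervalIntegral.integral_symm, intervalIntegral.integral_of_le (by linarith),
        setIntegral_eq_zero_of_ae_eq_zero, neg_zero]
      filter_upwards [measure_eq_zero_iff_ae_notMem.1 (measure_singleton (μ := volume) (-A))]
        with t htA ht
      apply h0
      rw [lt_abs]
      right
      have : t ≠ -A := fun h => htA (by simp [h])
      have := lt_of_le_of_ne ht.2 this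
      linarith
  refine ⟨v, ⟨?_, hasCompactSupport_of_abs_bound hvA⟩, hdv, hvA⟩
  rw [contDiff_infty_iff_deriv, hdv]
  exact ⟨fun x => (hd x).differentiableAt, hu⟩

namespace IsPrimitive

variable {f g p q : ℝ → ℝ}

theorem eq_integral (h : IsPrimitive f p) : f = fun x => f 0 + ∫ t in (0 : ℝ)..x, p t := by
  ext x; rw [h.2]; ring

theorem absolutelyContinuous (h : IsPrimitive f p) (a b : ℝ) :
    AbsolutelyContinuousOnInterval f a b := by
  have h1 := (h.1.toIntervalIntegrable a b).absolutelyContinuousOnInterval_intervalIntegral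
    (c := a) left_mem_uIcc
  have h2 : AbsolutelyContinuousOnInterval (fun _ : ℝ => f a) a b :=
    (LipschitzWith.const (f a)).lipschitzOnWith.absolutelyContinuousOnInterval
  have e : f = (fun _ : ℝ => f a) + fun x => ∫ v in a..x, p v := by
    funext x
    have := h.2 a x
    simp only [Pi.add_apply]
    linarith
  rw [e]
  exact h2.add h1

theorem ae_hasDerivAt (h : IsPrimitive f p) : ∀ᵐ x, HasDerivAt f (p x) x := by
  filter_upwards [LocallyIntegrable.ae_hasDerivAt_integral h.1] with x hx
  rw [h.eq_integral]
  exact (hx 0).const_add _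

theorem continuous (h : IsPrimitive f p) : Continuous f := by
  rw [h.eq_integral]
  exact continuous_const.add
    (intervalIntegral.continuous_primitive (fun a b => h.1.toIntervalIntegrable a b) 0)

theorem of_absolutelyContinuous (hf : ∀ a b, AbsolutelyContinuousOnInterval f a b)
    (hp : LocallyIntegrable p) (h : ∀ᵐ x, HasDerivAt f (p x) x) : IsPrimitive f p := by
  refine ⟨hp, fun a b => ?_⟩
  rw [← (hf a b).integral_deriv_eq_sub]
  apply intervalIntegral.integral_congr_ae
  filter_upwards [h] with x hx _
  exact hx.deriv.symm

theorem of_contDiff (hf : ContDiff ℝ 1 f) : IsPrimitive f (deriv f) := by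
  refine ⟨(hf.continuous_deriv le_rfl).locallyIntegrable, fun a b => ?_⟩
  exact intervalIntegral.integral_deriv_eq_sub
    (fun x _ => (hf.differentiable one_ne_zero).differentiableAt)
    ((hf.continuous_deriv le_rfl).intervalIntegrable _ _)

theorem add (hf : IsPrimitive f p) (hg : IsPrimitive g q) :
    IsPrimitive (fun x => f x + g x) (fun x => p x + q x) := by
  refine ⟨hf.1.add hg.1, fun a b => ?_⟩
  rw [intervalIntegral.integral_add (hf.1.toIntervalIntegrable a b) (hg.1.toIntervalIntegrable a b),
    hf.2, hg.2]
  ring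

theorem const_mul (hf : IsPrimitive f p) (c : ℝ) :
    IsPrimitive (fun x => c * f x) (fun x => c * p x) := by
  refine ⟨hf.1.smul c, fun a b => ?_⟩
  rw [intervalIntegral.integral_const_mul, hf.2]
  ring

theorem sub (hf : IsPrimitive f p) (hg : IsPrimitive g q) :
    IsPrimitive (fun x => f x - g x) (fun x => p x - q x) := by
  simpa [sub_eq_add_neg] using hf.add (hg.const_mul (-1))

theorem add_const (hf : IsPrimitive f p) (c : ℝ) : IsPrimitive (fun x => f x + c) p :=
  ⟨hf.1, fun a b => by rw [hf.2]; ring⟩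

theorem mul (hf : IsPrimitive f p) (hg : IsPrimitive g q) :
    IsPrimitive (fun x => f x * g x) (fun x => p x * g x + f x * q x) := by
  refine of_absolutelyContinuous
    (fun a b => (hf.absolutelyContinuous a b).mul (hg.absolutelyContinuous a b)) ?_ ?_
  · refine LocallyIntegrable.add ?_ ?_
    · simpa [mul_comm] using hf.1.continuous_mul hg.continuous
    · exact hg.1.continuous_mul hf.continuous
  · filter_upwards [hf.ae_hasDerivAt, hg.ae_hasDerivAt] with x h1 h2
    exact h1.mul h2

theorem _root_.AbsolutelyContinuousOnInterval.lipschitz_comp {F : ℝ → ℝ} {K : NNReal} {a b : ℝ}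
    (hF : LipschitzWith K F) (hf : AbsolutelyContinuousOnInterval f a b) :
    AbsolutelyContinuousOnInterval (fun x => F (f x)) a b := by
  apply squeeze_zero (fun t ↦ ?_) (fun t ↦ ?_) (by simpa using Tendsto.const_mul (K : ℝ) hf)
  · exact Finset.sum_nonneg (fun i hi ↦ by positivity)
  · rw [Finset.mul_sum]
    exact Finset.sum_le_sum fun i _ => hF.dist_le_mul _ _

theorem cos (hf : IsPrimitive f p) :
    IsPrimitive (fun x => Real.cos (f x)) (fun x => -Real.sin (f x) * p x) := by
  refine of_absolutelyContinuous
    (fun a b => (hf.absolutelyContinuous a b).lipschitz_comp Real.lipschitzWith_cos) ?_ ?_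
  · exact hf.1.continuous_mul (Real.continuous_sin.comp hf.continuous).neg
  · filter_upwards [hf.ae_hasDerivAt] with x h1
    exact h1.cos

theorem sin (hf : IsPrimitive f p) :
    IsPrimitive (fun x => Real.sin (f x)) (fun x => Real.cos (f x) * p x) := by
  refine of_absolutelyContinuous
    (fun a b => (hf.absolutelyContinuous a b).lipschitz_comp Real.lipschitzWith_sin) ?_ ?_
  · exact hf.1.continuous_mul (Real.continuous_cos.comp hf.continuous)
  · filter_upwards [hf.ae_hasDerivAt] with x h1
    exact h1.sin

theorem eq_const (hf : IsPrimitive f p) (hp : p =ᵐ[volume] 0) (x : ℝ) : f x = f 0 := by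
  have h := hf.2 0 x
  rw [intervalIntegral.integral_congr_ae (g := fun _ => (0 : ℝ)) (hp.mono fun x hx _ => hx)] at h
  simp at h
  linarith

theorem ae_unique (hf : IsPrimitive f p) (hg : IsPrimitive f q) : p =ᵐ[volume] q := by
  filter_upwards [hf.ae_hasDerivAt, hg.ae_hasDerivAt] with x h1 h2
  exact h1.unique h2

theorem integral_eq_zero (hf : IsPrimitive f p) (hs : HasCompactSupport f) :
    ∫ x, p x = 0 := by
  obtain ⟨A, hA, h0⟩ := exists_abs_bound_of_hasCompactSupport hs
  have hp0 : ∀ᵐ x, x ∉ Ioc (-(A + 1)) (A + 1) → p x = 0 := by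
    filter_upwards [hf.ae_hasDerivAt] with x hx hx'
    have hxA : A < |x| := by
      by_contra hle
      apply hx'
      have := abs_le.1 (not_lt.1 hle)
      constructor <;> linarith
    have : f =ᶠ[𝓝 x] fun _ => 0 := by
      filter_upwards [(isOpen_lt continuous_const continuous_abs).mem_nhds hxA] with y hy
      exact h0 y hy
    exact hx.unique ((hasDerivAt_const x (0 : ℝ)).congr_of_eventuallyEq this)
  have h1 : ∫ x, p x = ∫ x in Ioc (-(A + 1)) (A + 1), p x :=
    (setIntegral_eq_integral_of_ae_compl_eq_zero hp0).symm
  rw [h1, ← intervalIntegral.integral_of_le (by linarith), hf.2, h0, h0, sub_zero]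
  · rw [abs_neg, abs_of_nonneg] <;> linarith
  · rw [abs_of_nonneg] <;> linarith

theorem ae_eq_zero_of_notMem (hf : IsPrimitive f p) {K : Set ℝ} (hK : IsClosed K)
    (h0 : ∀ x ∉ K, f x = 0) : ∀ᵐ x, x ∉ K → p x = 0 := by
  filter_upwards [hf.ae_hasDerivAt] with x hx hxK
  have : f =ᶠ[𝓝 x] fun _ => 0 := by
    filter_upwards [hK.isOpen_compl.mem_nhds hxK] with y hy
    exact h0 y hy
  exact hx.unique ((hasDerivAt_const x (0 : ℝ)).congr_of_eventuallyEq this)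

theorem integral_deriv_mul (hf : IsPrimitive f p) {ζ : ℝ → ℝ} (hζ : ContDiff ℝ 1 ζ)
    (hs : HasCompactSupport ζ) : ∫ x, deriv ζ x * f x = -∫ x, ζ x * p x := by
  have h := ((of_contDiff hζ).mul hf).integral_eq_zero (hs.mul_right)
  rw [integral_add] at h
  · linarith
  · exact ((hζ.continuous_deriv le_rfl).mul hf.continuous).integrable_of_hasCompactSupport
      (hs.deriv.mul_right)
  · exact hf.1.integrable_smul_left_of_hasCompactSupport hζ.continuous hs

end IsPrimitive

/-- The du Bois-Reymond lemma: a function with a weak derivative is almost everywhere equal to a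
primitive of that derivative. -/
theorem exists_isPrimitive_of_weak {f g : ℝ → ℝ} (hf : LocallyIntegrable f)
    (hg : LocallyIntegrable g)
    (h : ∀ ζ : ℝ → ℝ, IsTest ζ → ∫ x, deriv ζ x * f x = -∫ x, ζ x * g x) :
    ∃ F, IsPrimitive F g ∧ f =ᵐ[volume] F := by
  set F₀ : ℝ → ℝ := fun x => ∫ t in (0 : ℝ)..x, g t with hF₀
  have hF : IsPrimitive F₀ g := ⟨hg, fun a b => by
    rw [hF₀]
    exact (intervalIntegral.integral_interval_sub_left (hg.toIntervalIntegrable _ _)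
      (hg.toIntervalIntegrable _ _)).symm⟩
  have hFl : LocallyIntegrable F₀ := hF.continuous.locallyIntegrable
  have hd : LocallyIntegrable (fun x => f x - F₀ x) := hf.sub hFl
  have hi : ∀ {u ζ : ℝ → ℝ}, LocallyIntegrable u → Continuous ζ → HasCompactSupport ζ →
      Integrable (fun x => ζ x * u x) := fun hu hc hs =>
    hu.integrable_smul_left_of_hasCompactSupport hc hs
  have h0 : ∀ ζ : ℝ → ℝ, IsTest ζ → ∫ x, deriv ζ x * (f x - F₀ x) = 0 := by
    intro ζ hζ
    have hc : Continuous (deriv ζ) := hζ.1.continuous_deriv (by simp)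
    simp_rw [mul_sub]
    rw [integral_sub (hi hf hc hζ.2.deriv) (hi hFl hc hζ.2.deriv), h ζ hζ,
      hF.integral_deriv_mul (hζ.1.of_le (by simp)) hζ.2, sub_self]
  -- a fixed test function of integral one
  let b : ContDiffBump (0 : ℝ) := ⟨1, 2, by norm_num, by norm_num⟩
  have hb1 : ContDiff ℝ ∞ (b.normed volume) := b.contDiff_normed
  have hb2 : HasCompactSupport (b.normed volume) := b.hasCompactSupport_normed
  have hb3 : ∫ x, b.normed volume x = 1 := b.integral_normed
  set c := ∫ x, b.normed volume x * (f x - F₀ x) with hc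
  refine ⟨fun x => F₀ x + c, hF.add_const c, ?_⟩
  have key : ∀ᵐ x, f x - F₀ x - c = 0 := by
    apply ae_eq_zero_of_integral_contDiff_smul_eq_zero (hd.sub (locallyIntegrable_const c))
    intro ζ hζ hs
    set a := ∫ x, ζ x with ha
    -- `ζ - (∫ ζ) b` has integral zero, hence is the derivative of a test function
    set u : ℝ → ℝ := fun x => ζ x - a * b.normed volume x with hu
    have hu1 : ContDiff ℝ ∞ u := hζ.sub (contDiff_const.mul hb1)
    have hu2 : HasCompactSupport u := hs.sub (hb2.mul_left)
    have hu3 : ∫ x, u x = 0 := by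
      rw [hu, integral_sub (hζ.continuous.integrable_of_hasCompactSupport hs)
        ((hb1.continuous.integrable_of_hasCompactSupport hb2).const_mul a), integral_const_mul,
        hb3, ← ha]
      ring
    obtain ⟨v, hv, hvd⟩ : ∃ v, IsTest v ∧ deriv v = u := by
      obtain ⟨A, hA, hA0⟩ := exists_abs_bound_of_hasCompactSupport hu2
      obtain ⟨v, hv, hvd, -⟩ := exists_isTest_deriv_eq hu1 hA hA0 hu3
      exact ⟨v, hv, hvd⟩
    have h1 := h0 v hv
    rw [hvd, hu] at h1
    simp only [sub_mul, mul_assoc] at h1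
    rw [integral_sub (hi hd hζ.continuous hs) ((hi hd hb1.continuous hb2).const_mul a),
      integral_const_mul, ← hc] at h1
    simp only [smul_eq_mul, Pi.sub_apply, mul_sub _ _ c]
    rw [integral_sub (hi hd hζ.continuous hs)
      ((hζ.continuous.integrable_of_hasCompactSupport hs).mul_const c), integral_mul_const, ← ha]
    linarith
  filter_upwards [key] with x hx
  linarith

/-- The chain rule `(e^{iφ})' = φ' (-sin φ, cos φ)` for weak derivatives. -/
theorem isWeakDeriv_of_isPrimitive {φ p : ℝ → ℝ} (h : IsPrimitive φ p) {m : ℝ → Circle}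
    (hm : ∀ᵐ x, m x = Circle.exp (φ x)) :
    IsWeakDeriv (fun x => (m x : ℂ))
      (fun x => ⟨-Real.sin (φ x) * p x, Real.cos (φ x) * p x⟩) := by
  have hc := h.cos
  have hs := h.sin
  have e : ∀ a b : ℝ, (⟨a, b⟩ : ℂ) = (a : ℂ) + (b : ℂ) * Complex.I := fun a b =>
    Complex.mk_eq_add_mul_I a b
  have hme : (fun x => (m x : ℂ)) =ᵐ[volume]
      fun x => (⟨Real.cos (φ x), Real.sin (φ x)⟩ : ℂ) := by
    filter_upwards [hm] with x hx
    rw [hx, Circle.coe_exp, Complex.exp_mul_I, e]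
    push_cast
    rfl
  have hL : ∀ {u v : ℝ → ℝ}, LocallyIntegrable u → LocallyIntegrable v →
      LocallyIntegrable (fun x => (⟨u x, v x⟩ : ℂ)) := by
    intro u v hu hv
    rw [locallyIntegrable_iff] at hu hv ⊢
    intro K hK
    simp_rw [e]
    exact (hu K hK).ofReal.add ((hv K hK).ofReal.mul_const _)
  have hI : ∀ {u v : ℝ → ℝ}, LocallyIntegrable u → LocallyIntegrable v → ∀ {ζ : ℝ → ℝ},
      Continuous ζ → HasCompactSupport ζ → ∫ x, ζ x • (⟨u x, v x⟩ : ℂ) =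
        ⟨∫ x, ζ x * u x, ∫ x, ζ x * v x⟩ := by
    intro u v hu hv ζ hζ hs
    have h1 : Integrable (fun x => ζ x • (⟨u x, v x⟩ : ℂ)) :=
      (hL hu hv).integrable_smul_left_of_hasCompactSupport hζ hs
    apply Complex.ext
    · have := Complex.reCLM.integral_comp_comm h1
      simp only [Complex.reCLM_apply, Complex.smul_re, smul_eq_mul] at this
      exact this.symm
    · have := Complex.imCLM.integral_comp_comm h1
      simp only [Complex.imCLM_apply, Complex.smul_im, smul_eq_mul] at this
      exact this.symm
  refine ⟨(hL hc.continuous.locallyIntegrable hs.continuous.locallyIntegrable).congr hme.symm,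
    hL hc.1 hs.1, fun ζ hζ => ?_⟩
  have h1 : ∫ x, deriv ζ x • (m x : ℂ) =
      ∫ x, deriv ζ x • (⟨Real.cos (φ x), Real.sin (φ x)⟩ : ℂ) :=
    integral_congr_ae (hme.mono fun x hx => by simp only [hx])
  rw [h1, hI hc.continuous.locallyIntegrable hs.continuous.locallyIntegrable
    (hζ.1.continuous_deriv (by simp)) hζ.2.deriv, hI hc.1 hs.1 hζ.1.continuous hζ.2,
    hc.integral_deriv_mul (hζ.1.of_le (by simp)) hζ.2,
    hs.integral_deriv_mul (hζ.1.of_le (by simp)) hζ.2]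
  apply Complex.ext <;> simp

theorem IsWeakDeriv.ae_unique {f g g' : ℝ → ℂ} (h : IsWeakDeriv f g) (h' : IsWeakDeriv f g') :
    g =ᵐ[volume] g' := by
  apply ae_eq_of_integral_contDiff_smul_eq h.2.1 h'.2.1
  intro ζ hζ hs
  have h1 := h.2.2 ζ ⟨hζ, hs⟩
  rw [h'.2.2 ζ ⟨hζ, hs⟩] at h1
  exact (neg_injective h1).symm

theorem weakDeriv_ae_eq {φ p : ℝ → ℝ} (h : IsPrimitive φ p) {m : ℝ → Circle}
    (hm : ∀ᵐ x, m x = Circle.exp (φ x)) :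
    weakDeriv m =ᵐ[volume] fun x => ⟨-Real.sin (φ x) * p x, Real.cos (φ x) * p x⟩ := by
  have hw := isWeakDeriv_of_isPrimitive h hm
  have hex : ∃ g : ℝ → ℂ, IsWeakDeriv (fun x => (m x : ℂ)) g := ⟨_, hw⟩
  rw [weakDeriv, dif_pos hex]
  exact hex.choose_spec.ae_unique hw

theorem weakDeriv_re_ae_eq {φ p : ℝ → ℝ} (h : IsPrimitive φ p) {m : ℝ → Circle}
    (hm : ∀ᵐ x, m x = Circle.exp (φ x)) :
    (fun x => (weakDeriv m x).re) =ᵐ[volume] fun x => -Real.sin (φ x) * p x := by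
  filter_upwards [weakDeriv_ae_eq h hm] with x hx
  rw [hx]

theorem norm_weakDeriv_sq_ae_eq {φ p : ℝ → ℝ} (h : IsPrimitive φ p) {m : ℝ → Circle}
    (hm : ∀ᵐ x, m x = Circle.exp (φ x)) :
    (fun x => ‖weakDeriv m x‖ ^ 2) =ᵐ[volume] fun x => p x ^ 2 := by
  filter_upwards [weakDeriv_ae_eq h hm] with x hx
  rw [hx, ← Complex.normSq_eq_norm_sq, Complex.normSq_mk]
  linear_combination p x ^ 2 * Real.sin_sq_add_cos_sq (φ x)

/-- A circle-valued map with a weak derivative has a locally absolutely continuous phase: with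
`p = m₁ m₂' - m₂ m₁'` and `φ' = p`, the product `m e^{-iφ}` is constant. -/
theorem exists_phase {m : ℝ → Circle} {g : ℝ → ℂ} (h : IsWeakDeriv (fun x => (m x : ℂ)) g) :
    ∃ φ p : ℝ → ℝ, IsPrimitive φ p ∧ ∀ᵐ x, m x = Circle.exp (φ x) := by
  obtain ⟨hm, hg, hw⟩ := h
  have hre : ∀ {u : ℝ → ℂ}, LocallyIntegrable u → LocallyIntegrable (fun x => (u x).re) := by
    intro u hu
    rw [locallyIntegrable_iff] at hu ⊢
    exact fun K hK => (hu K hK).re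
  have him : ∀ {u : ℝ → ℂ}, LocallyIntegrable u → LocallyIntegrable (fun x => (u x).im) := by
    intro u hu
    rw [locallyIntegrable_iff] at hu ⊢
    exact fun K hK => (hu K hK).im
  have hI : ∀ {u : ℝ → ℂ}, LocallyIntegrable u → ∀ {ζ : ℝ → ℝ}, Continuous ζ →
      HasCompactSupport ζ → Integrable (fun x => ζ x • u x) := fun hu _ hζ hs =>
    hu.integrable_smul_left_of_hasCompactSupport hζ hs
  obtain ⟨M₁, hM₁, e₁⟩ : ∃ F, IsPrimitive F (fun x => (g x).re) ∧
      (fun x => (m x : ℂ).re) =ᵐ[volume] F := by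
    apply exists_isPrimitive_of_weak (hre hm) (hre hg)
    intro ζ hζ
    have h1 := Complex.reCLM.integral_comp_comm
      (hI hm (hζ.1.continuous_deriv (by simp)) hζ.2.deriv)
    have h2 := Complex.reCLM.integral_comp_comm (hI hg hζ.1.continuous hζ.2)
    rw [hw ζ hζ, map_neg, ← h2] at h1
    simpa using h1
  obtain ⟨M₂, hM₂, e₂⟩ : ∃ F, IsPrimitive F (fun x => (g x).im) ∧
      (fun x => (m x : ℂ).im) =ᵐ[volume] F := by
    apply exists_isPrimitive_of_weak (him hm) (him hg)
    intro ζ hζ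
    have h1 := Complex.imCLM.integral_comp_comm
      (hI hm (hζ.1.continuous_deriv (by simp)) hζ.2.deriv)
    have h2 := Complex.imCLM.integral_comp_comm (hI hg hζ.1.continuous hζ.2)
    rw [hw ζ hζ, map_neg, ← h2] at h1
    simpa using h1
  have hunit : ∀ x, M₁ x * M₁ x + M₂ x * M₂ x = 1 := by
    have hae : (fun x => M₁ x * M₁ x + M₂ x * M₂ x) =ᵐ[volume] fun _ => 1 := by
      filter_upwards [e₁, e₂] with x h1 h2
      rw [← h1, ← h2, ← Complex.normSq_apply, Circle.normSq_coe]
    exact fun x => congrFun (Continuous.ae_eq_iff_eq volume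
      ((hM₁.continuous.mul hM₁.continuous).add (hM₂.continuous.mul hM₂.continuous))
      continuous_const |>.1 hae) x
  -- differentiating `|m|² = 1`
  have horth : ∀ᵐ x, M₁ x * (g x).re + M₂ x * (g x).im = 0 := by
    have h1 := (hM₁.mul hM₁).add (hM₂.mul hM₂)
    simp only [hunit] at h1
    have h2 : IsPrimitive (fun _ : ℝ => (1 : ℝ)) (fun _ => 0) := by
      simpa using IsPrimitive.of_contDiff (contDiff_const (c := (1 : ℝ)))
    filter_upwards [h1.ae_unique h2] with x hx
    linarith
  set p : ℝ → ℝ := fun x => M₁ x * (g x).im - M₂ x * (g x).re with hp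
  have hpl : LocallyIntegrable p :=
    ((him hg).continuous_mul hM₁.continuous).sub ((hre hg).continuous_mul hM₂.continuous)
  obtain ⟨φ, hφ⟩ : ∃ φ, IsPrimitive φ p := ⟨fun x => ∫ t in (0 : ℝ)..x, p t, hpl, fun a b =>
    (intervalIntegral.integral_interval_sub_left (hpl.toIntervalIntegrable _ _)
      (hpl.toIntervalIntegrable _ _)).symm⟩
  -- the real and imaginary parts of `m e^{-iφ}` are constant
  have hC := ((hM₁.mul hφ.cos).add (hM₂.mul hφ.sin)).eq_const (by
    filter_upwards [horth] with x hx
    simp only [hp, Pi.zero_apply]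
    linear_combination ((M₁ x * Real.cos (φ x) + M₂ x * Real.sin (φ x))) * hx -
      ((g x).re * Real.cos (φ x) + (g x).im * Real.sin (φ x)) * hunit x)
  have hS := ((hM₂.mul hφ.cos).sub (hM₁.mul hφ.sin)).eq_const (by
    filter_upwards [horth] with x hx
    simp only [hp, Pi.zero_apply]
    linear_combination ((M₂ x * Real.cos (φ x) - M₁ x * Real.sin (φ x))) * hx -
      ((g x).im * Real.cos (φ x) - (g x).re * Real.sin (φ x)) * hunit x)
  set C := M₁ 0 * Real.cos (φ 0) + M₂ 0 * Real.sin (φ 0) with hCdef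
  set S := M₂ 0 * Real.cos (φ 0) - M₁ 0 * Real.sin (φ 0) with hSdef
  have hCS : C ^ 2 + S ^ 2 = 1 := by
    rw [hCdef, hSdef]
    linear_combination hunit 0 + (M₁ 0 * M₁ 0 + M₂ 0 * M₂ 0) * Real.sin_sq_add_cos_sq (φ 0)
  have hn : ‖(⟨C, S⟩ : ℂ)‖ = 1 := by
    rw [← sq_eq_sq₀ (norm_nonneg _) zero_le_one, ← Complex.normSq_eq_norm_sq, Complex.normSq_mk]
    linarith
  have hn0 : (⟨C, S⟩ : ℂ) ≠ 0 := by
    intro h; rw [h] at hn; simp at hn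
  have hcos : Real.cos (Complex.arg ⟨C, S⟩) = C := by
    rw [Complex.cos_arg hn0, hn]; simp
  have hsin : Real.sin (Complex.arg ⟨C, S⟩) = S := by
    rw [Complex.sin_arg, hn]; simp
  refine ⟨_, p, hφ.add_const (Complex.arg ⟨C, S⟩), ?_⟩
  filter_upwards [e₁, e₂] with x h1 h2
  apply Circle.ext
  rw [Circle.coe_exp, Complex.exp_mul_I, ← Complex.ofReal_cos, ← Complex.ofReal_sin,
    Real.cos_add, Real.sin_add, hcos, hsin, ← hC x, ← hS x]
  have h3 := Real.sin_sq_add_cos_sq (φ x)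
  apply Complex.ext
  · rw [h1]
    simp only [Complex.add_re, Complex.mul_re, Complex.ofReal_re, Complex.ofReal_im, Complex.I_re,
      Complex.I_im]
    linear_combination (-M₁ x) * h3
  · rw [h2]
    simp only [Complex.add_im, Complex.mul_im, Complex.ofReal_re, Complex.ofReal_im, Complex.I_re,
      Complex.I_im]
    linear_combination (-M₂ x) * h3

/-! ### The Neumann problem on the half-plane -/

theorem inner_fin_two (v w : EuclideanSpace ℝ (Fin 2)) :
    inner ℝ v w = v 0 * w 0 + v 1 * w 1 := by
  rw [PiLp.inner_apply, Fin.sum_univ_two]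
  simp [mul_comm]

theorem norm_sq_fin_two (v : EuclideanSpace ℝ (Fin 2)) : ‖v‖ ^ 2 = v 0 ^ 2 + v 1 ^ 2 := by
  rw [← real_inner_self_eq_norm_sq, inner_fin_two]
  ring

theorem volume_restrict_halfPlane :
    (volume : Measure (ℝ × ℝ)).restrict halfPlane =
      (volume : Measure ℝ).prod (volume.restrict (Ioi (0 : ℝ))) := by
  have h : halfPlane = (univ : Set ℝ) ×ˢ Ioi (0 : ℝ) := by
    ext x; simp [halfPlane]
  rw [h, Measure.volume_eq_prod, ← Measure.prod_restrict, Measure.restrict_univ]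

theorem measurableSet_halfPlane : MeasurableSet halfPlane :=
  measurableSet_lt measurable_const measurable_snd

section Grad

variable {ζ ξ : ℝ × ℝ → ℝ}

theorem IsTest.continuous_grad (h : IsTest ζ) : Continuous (grad ζ) := by
  have hc : Continuous (fderiv ℝ ζ) := h.1.continuous_fderiv (by simp)
  refine (PiLp.continuous_toLp 2 _).comp (continuous_pi fun i => ?_)
  fin_cases i
  · exact hc.clm_apply continuous_const
  · exact hc.clm_apply continuous_const

theorem IsTest.hasCompactSupport_grad (h : IsTest ζ) : HasCompactSupport (grad ζ) := by
  refine (h.2.fderiv (𝕜 := ℝ)).mono fun x hx hx' => hx ?_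
  ext i
  fin_cases i <;> simp [grad, hx']

theorem IsTest.memLp_grad (h : IsTest ζ) : MemLp (grad ζ) 2 (volume.restrict halfPlane) :=
  (h.continuous_grad.memLp_of_hasCompactSupport h.hasCompactSupport_grad).restrict _

/-- The gradient of a test function as a square-integrable field on the half-plane. -/
def gradField (ζ : ℝ × ℝ → ℝ) (h : IsTest ζ) : L2Field := h.memLp_grad.toLp

theorem coeFn_gradField (h : IsTest ζ) :
    gradField ζ h =ᵐ[volume.restrict halfPlane] grad ζ := h.memLp_grad.coeFn_toLp

theorem inner_gradField (G : L2Field) (h : IsTest ζ) :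
    inner ℝ G (gradField ζ h) = ∫ x in halfPlane, inner ℝ (G x) (grad ζ x) := by
  rw [L2.inner_def]
  apply integral_congr_ae
  filter_upwards [coeFn_gradField h] with x hx
  rw [hx]

theorem IsTest.hasFDerivAt (h : IsTest ζ) (x : ℝ × ℝ) : HasFDerivAt ζ (fderiv ℝ ζ x) x :=
  ((h.1.differentiable (by simp)) x).hasFDerivAt

/-- The gradients of test functions, whose closure is `HDotOne`. -/
def gradSubmodule : Submodule ℝ L2Field where
  carrier := {G | ∃ ζ : ℝ × ℝ → ℝ, IsTest ζ ∧ G =ᵐ[volume.restrict halfPlane] grad ζ}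
  zero_mem' := by
    refine ⟨fun _ => 0, ⟨contDiff_const, HasCompactSupport.zero⟩, ?_⟩
    filter_upwards [Lp.coeFn_zero (EuclideanSpace ℝ (Fin 2)) 2 (volume.restrict halfPlane)]
      with x hx
    rw [hx]
    ext i
    fin_cases i <;> simp [grad]
  add_mem' := by
    rintro G G' ⟨ζ, hζ, h⟩ ⟨ξ, hξ, h'⟩
    refine ⟨fun x => ζ x + ξ x, ⟨hζ.1.add hξ.1, hζ.2.add hξ.2⟩, ?_⟩
    filter_upwards [h, h', Lp.coeFn_add G G'] with x h1 h2 h3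
    rw [h3, Pi.add_apply, h1, h2]
    have hd : fderiv ℝ (fun x => ζ x + ξ x) x = fderiv ℝ ζ x + fderiv ℝ ξ x :=
      ((hζ.hasFDerivAt x).add (hξ.hasFDerivAt x)).fderiv
    ext i
    fin_cases i <;> simp [grad, hd]
  smul_mem' := by
    rintro c G ⟨ζ, hζ, h⟩
    refine ⟨fun x => c • ζ x, ⟨hζ.1.const_smul c, hζ.2.mono fun x hx hx' => hx (by simp [hx'])⟩, ?_⟩
    filter_upwards [h, Lp.coeFn_smul c G] with x h1 h2
    rw [h2, Pi.smul_apply, h1]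
    have hd : fderiv ℝ (fun x => c * ζ x) x = c • fderiv ℝ ζ x :=
      ((hζ.hasFDerivAt x).const_smul c).fderiv
    ext i
    fin_cases i <;> simp [grad, hd]

theorem gradField_mem (h : IsTest ζ) : gradField ζ h ∈ gradSubmodule :=
  ⟨ζ, h, coeFn_gradField h⟩

theorem eq_gradField {G : L2Field} (hG : G ∈ gradSubmodule) :
    ∃ ζ, ∃ h : IsTest ζ, G = gradField ζ h := by
  obtain ⟨ζ, h, hG⟩ := hG
  exact ⟨ζ, h, Lp.ext (hG.trans (coeFn_gradField h).symm)⟩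

end Grad

/-- `G` is the gradient of the finite-energy harmonic function on the half-plane with Neumann
datum `-q` on the boundary, in the weak sense. The stray field of `m` is the case `q = m₁'`. -/
def IsNeumann (q : ℝ → ℝ) (G : L2Field) : Prop :=
  G ∈ HDotOne ∧ ∀ ζ : ℝ × ℝ → ℝ, IsTest ζ →
    ∫ x in halfPlane, inner ℝ (G x) (grad ζ x) = ∫ s, q s * ζ (s, 0)

theorem IsTest.trace {ζ : ℝ × ℝ → ℝ} (h : IsTest ζ) (y : ℝ) : IsTest fun s => ζ (s, y) := by
  refine ⟨h.1.comp (contDiff_id.prodMk contDiff_const), ?_⟩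
  refine HasCompactSupport.intro (h.2.isCompact.image continuous_fst) fun x hx => ?_
  by_contra hne
  exact hx ⟨(x, y), subset_tsupport _ hne, rfl⟩

namespace IsNeumann

variable {q q' : ℝ → ℝ} {G G' : L2Field}

theorem inner_gradField (h : IsNeumann q G) {ζ : ℝ × ℝ → ℝ} (hζ : IsTest ζ) :
    inner ℝ G (gradField ζ hζ) = ∫ s, q s * ζ (s, 0) := by
  rw [NeelWall.inner_gradField, h.2 ζ hζ]

theorem congr_ae (h : IsNeumann q G) (hq : q =ᵐ[volume] q') : IsNeumann q' G := by
  refine ⟨h.1, fun ζ hζ => ?_⟩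
  rw [h.2 ζ hζ]
  exact integral_congr_ae (hq.mono fun x hx => by simp only [hx])

theorem add (h : IsNeumann q G) (h' : IsNeumann q' G') (hq : LocallyIntegrable q)
    (hq' : LocallyIntegrable q') : IsNeumann (fun s => q s + q' s) (G + G') := by
  refine ⟨gradSubmodule.topologicalClosure.add_mem h.1 h'.1, fun ζ hζ => ?_⟩
  have ht := hζ.trace 0
  have hi : ∀ {u : ℝ → ℝ}, LocallyIntegrable u → Integrable (fun s => u s * ζ (s, 0)) :=
    fun hu => by
      simpa [mul_comm] using hu.integrable_smul_left_of_hasCompactSupport ht.1.continuous ht.2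
  simp_rw [add_mul]
  rw [← NeelWall.inner_gradField _ hζ, inner_add_left, h.inner_gradField hζ,
    h'.inner_gradField hζ, integral_add (hi hq) (hi hq')]

theorem smul (h : IsNeumann q G) (c : ℝ) : IsNeumann (fun s => c * q s) (c • G) := by
  refine ⟨gradSubmodule.topologicalClosure.smul_mem c h.1, fun ζ hζ => ?_⟩
  simp_rw [mul_assoc]
  rw [← NeelWall.inner_gradField _ hζ, real_inner_smul_left, h.inner_gradField hζ,
    integral_const_mul]

/-- A Neumann field is bounded by the norm of the boundary functional on gradients of test
functions, because these are dense in `HDotOne`. -/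
theorem norm_le (h : IsNeumann q G) {A : ℝ}
    (hb : ∀ ζ (hζ : IsTest ζ), ∫ s, q s * ζ (s, 0) ≤ A * ‖gradField ζ hζ‖) (hA : 0 ≤ A) :
    ‖G‖ ≤ A := by
  have hcl : IsClosed {U : L2Field | inner ℝ G U ≤ A * ‖U‖} :=
    isClosed_le (by fun_prop) (by fun_prop)
  have hsub : (gradSubmodule : Set L2Field) ⊆ {U : L2Field | inner ℝ G U ≤ A * ‖U‖} := by
    intro U hU
    obtain ⟨ζ, hζ, rfl⟩ := eq_gradField hU
    simp only [mem_ofPred_eq, h.inner_gradField hζ]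
    exact hb ζ hζ
  have := closure_minimal hsub hcl h.1
  rw [mem_ofPred_eq, real_inner_self_eq_norm_sq] at this
  by_contra hlt
  nlinarith

theorem unique (h : IsNeumann q G) (h' : IsNeumann q G') : G = G' := by
  have hd : IsNeumann (fun _ => 0) (G - G') := by
    refine ⟨gradSubmodule.topologicalClosure.sub_mem h.1 h'.1, fun ζ hζ => ?_⟩
    rw [← NeelWall.inner_gradField _ hζ, inner_sub_left, h.inner_gradField hζ,
      h'.inner_gradField hζ]
    simp
  have := hd.norm_le (A := 0) (by simp) le_rfl
  exact sub_eq_zero.1 (norm_le_zero_iff.1 this)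

/-- If some square-integrable field represents the boundary functional, then its projection onto
`HDotOne` solves the Neumann problem. -/
theorem exists_of_field {K : L2Field}
    (hK : ∀ ζ (hζ : IsTest ζ), inner ℝ K (gradField ζ hζ) = ∫ s, q s * ζ (s, 0)) :
    ∃ G, IsNeumann q G := by
  let H := gradSubmodule.topologicalClosure
  have : CompleteSpace H := (gradSubmodule.isClosed_topologicalClosure).completeSpace_coe
  refine ⟨H.starProjection K, H.starProjection_apply_mem K, fun ζ hζ => ?_⟩
  have hm : gradField ζ hζ ∈ H := gradSubmodule.le_topologicalClosure (gradField_mem hζ)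
  rw [← NeelWall.inner_gradField _ hζ, ← hK ζ hζ,
    H.inner_starProjection_left_eq_right, Submodule.starProjection_eq_self_iff.2 hm]

end IsNeumann

theorem strayDirichlet_eq {m : ℝ → Circle} {G : L2Field} (h : IsStrayField m G) :
    strayDirichlet m = ENNReal.ofReal (‖G‖ ^ 2) := by
  have hG : ∀ G : L2Field, ∫⁻ x in halfPlane, ‖G x‖ₑ ^ 2 = ENNReal.ofReal (‖G‖ ^ 2) := by
    intro G
    rw [← real_inner_self_eq_norm_sq, L2.inner_def, ofReal_integral_eq_lintegral_ofReal
      (L2.integrable_inner G G) (.of_forall fun x => real_inner_self_nonneg)]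
    refine lintegral_congr fun x => ?_
    rw [real_inner_self_eq_norm_sq, ENNReal.ofReal_pow (norm_nonneg _), ofReal_norm]
  apply le_antisymm
  · refine (iInf₂_le G h).trans (hG G).le
  · refine le_iInf₂ fun G' h' => ?_
    rw [IsNeumann.unique h' h, hG]

theorem exists_isStrayField {m : ℝ → Circle} (h : strayDirichlet m < ⊤) :
    ∃ G, IsStrayField m G := by
  by_contra hne
  push Not at hne
  simp [strayDirichlet, hne] at h

/-! ### The interpolation bound for the stray field -/

theorem memLp_mul_prod {f a : ℝ → ℝ} {μ ν : Measure ℝ} [SFinite μ] [SFinite ν]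
    (hf : MemLp f 2 μ) (ha : MemLp a 2 ν) :
    MemLp (fun z : ℝ × ℝ => f z.1 * a z.2) 2 (μ.prod ν) := by
  have hm : AEStronglyMeasurable (fun z : ℝ × ℝ => f z.1 * a z.2) (μ.prod ν) :=
    hf.aestronglyMeasurable.comp_fst.mul ha.aestronglyMeasurable.comp_snd
  rw [memLp_two_iff_integrable_sq hm]
  simpa only [mul_pow] using hf.integrable_sq.mul_prod ha.integrable_sq

theorem memLp_toLp_fin_two {α : Type*} [MeasurableSpace α] {μ : Measure α} {u v : α → ℝ}
    (hu : MemLp u 2 μ) (hv : MemLp v 2 μ) :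
    MemLp (fun z => (!₂[u z, v z] : EuclideanSpace ℝ (Fin 2))) 2 μ := by
  set L₁ : ℝ →L[ℝ] EuclideanSpace ℝ (Fin 2) :=
    ContinuousLinearMap.toSpanSingleton ℝ !₂[1, 0] with hL₁
  set L₂ : ℝ →L[ℝ] EuclideanSpace ℝ (Fin 2) :=
    ContinuousLinearMap.toSpanSingleton ℝ !₂[0, 1] with hL₂
  have h := (L₁.comp_memLp' hu).add (L₂.comp_memLp' hv)
  refine h.ae_eq (.of_forall fun z => ?_)
  ext i
  fin_cases i <;> simp [hL₁, hL₂]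

/-- For `f' = q`, the functional `ζ ↦ ∫ q ζ(·, 0)` is represented by a field supported in the
strip of height `δ`; integrating by parts in both variables moves the boundary integral into
the strip. -/
theorem exists_strip_field {f q : ℝ → ℝ} (h : IsPrimitive f q) (hf : MemLp f 2) (hq : MemLp q 2)
    {δ : ℝ} (hδ : 0 < δ) :
    ∃ K : L2Field, (∀ ζ (hζ : IsTest ζ), inner ℝ K (gradField ζ hζ) = ∫ s, q s * ζ (s, 0)) ∧
      ‖K‖ ^ 2 ≤ (1 / δ) * (∫ x, f x ^ 2) + δ * ∫ x, q x ^ 2 := by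
  set ν : Measure ℝ := volume.restrict (Ioi (0 : ℝ)) with hν
  set a : ℝ → ℝ := (Ioc 0 δ).indicator fun _ => -(1 / δ) with ha
  set b : ℝ → ℝ := (Ioc 0 δ).indicator fun y => -(1 - y / δ) with hb
  have hsub : Ioc 0 δ ⊆ Ioi (0 : ℝ) := fun y hy => hy.1
  have hνr : ν.restrict (Ioc 0 δ) = volume.restrict (Ioc 0 δ) := by
    rw [hν, Measure.restrict_restrict measurableSet_Ioc, inter_eq_left.2 hsub]
  have hind : ∀ g : ℝ → ℝ, ∫ y, (Ioc 0 δ).indicator g y ∂ν = ∫ y in (0 : ℝ)..δ, g y := by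
    intro g
    rw [integral_indicator measurableSet_Ioc, hνr, intervalIntegral.integral_of_le hδ.le]
  have hbb : ∀ y ∈ Ioc 0 δ, |-(1 - y / δ)| ≤ 1 := by
    intro y hy
    have h1 : 0 < y / δ := div_pos hy.1 hδ
    have h2 : y / δ ≤ 1 := (div_le_one hδ).2 hy.2
    rw [abs_le]
    constructor <;> linarith
  have ha2 : MemLp a 2 ν := by
    rw [ha, memLp_indicator_iff_restrict measurableSet_Ioc, hνr]
    exact memLp_const _
  have hb2 : MemLp b 2 ν := by
    rw [hb, memLp_indicator_iff_restrict measurableSet_Ioc, hνr]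
    refine MemLp.of_bound (by fun_prop) 1 ?_
    filter_upwards [ae_restrict_mem measurableSet_Ioc] with y hy
    exact hbb y hy
  have hau : MemLp (fun z : ℝ × ℝ => f z.1 * a z.2) 2 (volume.prod ν) := memLp_mul_prod hf ha2
  have hbv : MemLp (fun z : ℝ × ℝ => q z.1 * b z.2) 2 (volume.prod ν) := memLp_mul_prod hq hb2
  have hqa : MemLp (fun z : ℝ × ℝ => q z.1 * a z.2) 2 (volume.prod ν) := memLp_mul_prod hq ha2
  have hK := memLp_toLp_fin_two hau hbv
  rw [← volume_restrict_halfPlane] at hK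
  refine ⟨hK.toLp, fun ζ hζ => ?_, ?_⟩
  · have hcf : Continuous (fderiv ℝ ζ) := hζ.1.continuous_fderiv (by simp)
    have hd1 : ∀ x y, HasDerivAt (fun s => ζ (s, y)) (fderiv ℝ ζ (x, y) (1, 0)) x := by
      intro x y
      exact (hζ.hasFDerivAt (x, y)).comp_hasDerivAt x
        ((hasDerivAt_id x).prodMk (hasDerivAt_const x y))
    have hd2 : ∀ x y, HasDerivAt (fun t => ζ (x, t)) (fderiv ℝ ζ (x, y) (0, 1)) y := by
      intro x y
      exact (hζ.hasFDerivAt (x, y)).comp_hasDerivAt y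
        ((hasDerivAt_const y x).prodMk (hasDerivAt_id y))
    have hm1 : ∀ e, MemLp (fun z => fderiv ℝ ζ z e) 2 (volume.prod ν) := by
      intro e
      rw [← volume_restrict_halfPlane]
      refine (Continuous.memLp_of_hasCompactSupport (hcf.clm_apply continuous_const) ?_).restrict _
      exact (hζ.2.fderiv (𝕜 := ℝ)).mono fun x hx hx' => hx (by simp [hx'])
    have hm0 : MemLp ζ 2 (volume.prod ν) := by
      rw [← volume_restrict_halfPlane]
      exact (hζ.1.continuous.memLp_of_hasCompactSupport hζ.2).restrict _
    have hi1 : Integrable (fun z : ℝ × ℝ => f z.1 * a z.2 * fderiv ℝ ζ z (1, 0))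
        (volume.prod ν) := hau.integrable_mul (hm1 (1, 0))
    have hi2 : Integrable (fun z : ℝ × ℝ => q z.1 * b z.2 * fderiv ℝ ζ z (0, 1))
        (volume.prod ν) := hbv.integrable_mul (hm1 (0, 1))
    have hi3 : Integrable (fun z : ℝ × ℝ => q z.1 * a z.2 * ζ z) (volume.prod ν) :=
      hqa.integrable_mul hm0
    have e1 : inner ℝ (hK.toLp) (gradField ζ hζ) =
        (∫ z, f z.1 * a z.2 * fderiv ℝ ζ z (1, 0) ∂(volume.prod ν)) +
          ∫ z, q z.1 * b z.2 * fderiv ℝ ζ z (0, 1) ∂(volume.prod ν) := by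
      rw [← integral_add hi1 hi2, ← volume_restrict_halfPlane, inner_gradField]
      apply integral_congr_ae
      filter_upwards [hK.coeFn_toLp] with z hz
      rw [hz, inner_fin_two]
      simp [grad]
    have e2 : ∫ z, f z.1 * a z.2 * fderiv ℝ ζ z (1, 0) ∂(volume.prod ν) =
        -∫ z, q z.1 * a z.2 * ζ z ∂(volume.prod ν) := by
      rw [integral_prod_symm _ hi1, integral_prod_symm _ hi3, ← integral_neg]
      congr 1
      ext y
      have ht := hζ.trace y
      have := h.integral_deriv_mul (ht.1.of_le (by simp)) ht.2
      simp only [(hd1 _ y).deriv] at this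
      calc ∫ x, f x * a y * fderiv ℝ ζ (x, y) (1, 0)
          = ∫ x, a y * (fderiv ℝ ζ (x, y) (1, 0) * f x) := by congr 1; ext x; ring
        _ = -∫ x, a y * (ζ (x, y) * q x) := by
            rw [integral_const_mul, this, integral_const_mul]; ring
        _ = _ := by congr 2; ext x; ring
    have e3 : ∫ z, q z.1 * b z.2 * fderiv ℝ ζ z (0, 1) ∂(volume.prod ν) =
        (∫ s, q s * ζ (s, 0)) + ∫ z, q z.1 * a z.2 * ζ z ∂(volume.prod ν) := by
      have hq0 : Integrable (fun s => q s * ζ (s, 0)) := by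
        have ht := hζ.trace 0
        exact hq.integrable_mul (ht.1.continuous.memLp_of_hasCompactSupport (p := 2) ht.2)
      rw [integral_prod _ hi2, integral_prod _ hi3, ← integral_add hq0 hi3.integral_prod_left]
      congr 1
      ext x
      have hcx1 : Continuous fun y => fderiv ℝ ζ (x, y) (0, 1) :=
        (hcf.clm_apply continuous_const).comp (by fun_prop : Continuous fun y : ℝ => (x, y))
      have hcx0 : Continuous fun y => ζ (x, y) := hζ.1.continuous.comp (by fun_prop)
      have ibp := intervalIntegral.integral_mul_deriv_eq_deriv_mul
        (a := 0) (b := δ) (u := fun y => -(1 - y / δ)) (u' := fun _ => 1 / δ)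
        (v := fun y => ζ (x, y)) (v' := fun y => fderiv ℝ ζ (x, y) (0, 1))
        (fun y _ => by
          simpa [neg_sub] using ((hasDerivAt_id y).div_const δ).sub_const 1)
        (fun y _ => hd2 x y) (continuous_const.intervalIntegrable _ _)
        (hcx1.intervalIntegrable _ _)
      have l1 : ∫ y, q x * b y * fderiv ℝ ζ (x, y) (0, 1) ∂ν =
          q x * ∫ y in (0 : ℝ)..δ, -(1 - y / δ) * fderiv ℝ ζ (x, y) (0, 1) := by
        rw [← hind, ← integral_const_mul]
        congr 1
        ext y
        by_cases hy : y ∈ Ioc 0 δ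
        · simp [hb, hy]; ring
        · simp only [hb, indicator_of_notMem hy]; ring
      have l2 : ∫ y, q x * a y * ζ (x, y) ∂ν =
          q x * ∫ y in (0 : ℝ)..δ, -(1 / δ * ζ (x, y)) := by
        rw [← hind, ← integral_const_mul]
        congr 1
        ext y
        by_cases hy : y ∈ Ioc 0 δ
        · simp [ha, hy]; ring
        · simp only [ha, indicator_of_notMem hy]; ring
      rw [l1, l2, ibp, intervalIntegral.integral_neg, div_self hδ.ne']
      ring
    rw [e1, e2, e3]
    ring
  · have hn : ‖hK.toLp‖ ^ 2 = (∫ z, f z.1 ^ 2 * a z.2 ^ 2 ∂(volume.prod ν)) +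
        ∫ z, q z.1 ^ 2 * b z.2 ^ 2 ∂(volume.prod ν) := by
      rw [← integral_add (by simpa only [mul_pow] using hau.integrable_sq)
        (by simpa only [mul_pow] using hbv.integrable_sq), ← volume_restrict_halfPlane,
        ← real_inner_self_eq_norm_sq, L2.inner_def]
      apply integral_congr_ae
      filter_upwards [hK.coeFn_toLp] with z hz
      rw [hz, inner_fin_two]
      simp
      ring
    have ia : ∫ y, a y ^ 2 ∂ν = 1 / δ := by
      have : (fun y => a y ^ 2) = (Ioc 0 δ).indicator fun _ => (1 / δ) ^ 2 := by
        ext y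
        by_cases hy : y ∈ Ioc 0 δ <;> simp [ha, hy]
      rw [this, hind]
      simp
      field_simp
    have ib : ∫ y, b y ^ 2 ∂ν ≤ δ := by
      have h1 : ∀ y, b y ^ 2 ≤ (Ioc 0 δ).indicator (fun _ => (1 : ℝ)) y := by
        intro y
        by_cases hy : y ∈ Ioc 0 δ
        · have := hbb y hy
          simp only [hb, indicator_of_mem hy]
          rw [← sq_abs]
          exact pow_le_one₀ (abs_nonneg _) this
        · simp [hb, indicator_of_notMem hy]
      calc ∫ y, b y ^ 2 ∂ν ≤ ∫ y, (Ioc 0 δ).indicator (fun _ => (1 : ℝ)) y ∂ν := by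
            refine integral_mono hb2.integrable_sq ?_ h1
            rw [integrable_indicator_iff measurableSet_Ioc, IntegrableOn, hνr]
            exact integrable_const _
        _ = δ := by rw [hind]; simp
    rw [hn, integral_prod_mul (fun x => f x ^ 2) (fun y => a y ^ 2),
      integral_prod_mul (fun x => q x ^ 2) (fun y => b y ^ 2), ia]
    have : 0 ≤ ∫ x, q x ^ 2 := integral_nonneg fun x => sq_nonneg _
    nlinarith

/-- The interpolation bound `‖f‖_{H^{1/2}}² ≤ ‖f‖² / δ + δ ‖f'‖²` for the stray field generated
by `f`. -/
theorem IsNeumann.norm_sq_le {f q : ℝ → ℝ} {G : L2Field} (hG : IsNeumann q G)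
    (h : IsPrimitive f q) (hf : MemLp f 2) (hq : MemLp q 2) {δ : ℝ} (hδ : 0 < δ) :
    ‖G‖ ^ 2 ≤ (1 / δ) * (∫ x, f x ^ 2) + δ * ∫ x, q x ^ 2 := by
  obtain ⟨K, hK, hn⟩ := exists_strip_field h hf hq hδ
  refine le_trans ?_ hn
  have : ‖G‖ ≤ ‖K‖ := hG.norm_le (fun ζ hζ => by
    rw [← hK ζ hζ]; exact real_inner_le_norm _ _) (norm_nonneg _)
  gcongr

theorem exists_isNeumann {f q : ℝ → ℝ} (h : IsPrimitive f q) (hf : MemLp f 2) (hq : MemLp q 2) :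
    ∃ G, IsNeumann q G := by
  obtain ⟨K, hK, -⟩ := exists_strip_field h hf hq one_pos
  exact IsNeumann.exists_of_field hK

/-! ### Phases of finite energy -/

theorem inner_toLp_toLp {α : Type*} [MeasurableSpace α] {μ : Measure α} {u v : α → ℝ}
    (hu : MemLp u 2 μ) (hv : MemLp v 2 μ) :
    inner ℝ hu.toLp hv.toLp = ∫ x, u x * v x ∂μ := by
  rw [L2.inner_def]
  apply integral_congr_ae
  filter_upwards [hu.coeFn_toLp, hv.coeFn_toLp] with x h1 h2
  rw [h1, h2]
  simp [mul_comm]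

theorem sq_integral_mul_le {α : Type*} [MeasurableSpace α] {μ : Measure α} {f g : α → ℝ}
    (hf : MemLp f 2 μ) (hg : MemLp g 2 μ) :
    (∫ x, f x * g x ∂μ) ^ 2 ≤ (∫ x, f x ^ 2 ∂μ) * ∫ x, g x ^ 2 ∂μ := by
  have := real_inner_mul_inner_self_le hf.toLp hg.toLp
  rw [inner_toLp_toLp, inner_toLp_toLp, inner_toLp_toLp] at this
  simpa only [sq] using this

theorem integral_sq_le_of_eLpNorm_le {f : ℝ → ℝ} (hf : MemLp f 2) {ε : ℝ} (hε : 0 ≤ ε)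
    (h : eLpNorm f 2 volume ≤ ENNReal.ofReal ε) : ∫ x, f x ^ 2 ≤ ε ^ 2 := by
  have h1 : ‖hf.toLp‖ ≤ ε := by
    rw [Lp.norm_toLp]
    exact ENNReal.toReal_le_of_le_ofReal hε h
  simp only [sq (f _)]
  rw [← inner_toLp_toLp hf hf, real_inner_self_eq_norm_sq]
  gcongr

theorem sq_intervalIntegral_le {f : ℝ → ℝ} (hf : MemLp f 2) {a b : ℝ} (hab : a ≤ b) :
    (∫ x in a..b, f x) ^ 2 ≤ (b - a) * ∫ x in Icc a b, f x ^ 2 := by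
  have h := sq_integral_mul_le (μ := volume.restrict (Icc a b)) (hf.restrict _)
    (memLp_const (1 : ℝ))
  simp only [mul_one, one_pow, integral_const, smul_eq_mul] at h
  rw [intervalIntegral.integral_of_le hab, ← integral_Icc_eq_integral_Ioc]
  simpa [Measure.real, hab, mul_comm] using h

theorem abs_sub_le_sq_of_abs_deriv_le {f f' : ℝ → ℝ} (hf : ∀ u, HasDerivAt f (f' u) u)
    (h : ∀ u, |f' u| ≤ |u|) (t : ℝ) : |f t - f 0| ≤ t ^ 2 := by
  have := (convex_Icc (-|t|) |t|).norm_image_sub_le_of_norm_hasDerivWithin_le (f := f) (f' := f')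
    (C := |t|) (x := 0) (y := t) (fun u _ => (hf u).hasDerivWithinAt)
    (fun u hu => (h u).trans (abs_le.2 hu))
    ⟨by simp, abs_nonneg t⟩ (abs_le.1 le_rfl)
  simpa [sq, abs_mul_abs_self] using this

theorem abs_sin_add_sub_sin_le (a t : ℝ) : |Real.sin (a + t) - Real.sin a| ≤ |t| := by
  simpa [Real.dist_eq] using Real.lipschitzWith_sin.dist_le_mul (a + t) a

theorem abs_cos_add_sub_cos_le (a t : ℝ) : |Real.cos (a + t) - Real.cos a| ≤ |t| := by
  simpa [Real.dist_eq] using Real.lipschitzWith_cos.dist_le_mul (a + t) a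

theorem abs_cos_remainder_le (a t : ℝ) :
    |Real.cos (a + t) - Real.cos a + Real.sin a * t| ≤ t ^ 2 := by
  have := abs_sub_le_sq_of_abs_deriv_le (f := fun t => Real.cos (a + t) + Real.sin a * t)
    (f' := fun t => -Real.sin (a + t) * 1 + Real.sin a * 1)
    (fun u => (((hasDerivAt_id u).const_add a).cos).add ((hasDerivAt_id u).const_mul _))
    (fun u => by
      have := abs_sin_add_sub_sin_le a u
      rw [← abs_neg]
      convert this using 2
      ring) t
  convert this using 2
  simp
  ring

theorem abs_sin_remainder_le (a t : ℝ) :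
    |Real.sin (a + t) - Real.sin a - Real.cos a * t| ≤ t ^ 2 := by
  have := abs_cos_remainder_le (a - Real.pi / 2) t
  rw [show a - Real.pi / 2 + t = a + t - Real.pi / 2 by ring, Real.cos_sub_pi_div_two,
    Real.cos_sub_pi_div_two, Real.sin_sub_pi_div_two] at this
  convert this using 2
  ring

theorem anisotropy_exp (h t : ℝ) : anisotropy h (Circle.exp t) =
    (1 / 2) * (Real.cos t ^ 2 - 2 * h * Real.cos t + 2 * h * min h 1 - (min h 1) ^ 2) := by
  rw [anisotropy, Circle.coe_exp, Complex.exp_ofReal_mul_I_re]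

theorem anisotropy_nonneg (h : ℝ) (z : Circle) : 0 ≤ anisotropy h z := by
  have h1 : (z : ℂ).re ≤ 1 := by
    have := Complex.re_le_norm (z : ℂ)
    rwa [Circle.norm_coe] at this
  rw [anisotropy]
  rcases le_total h 1 with hh | hh
  · rw [min_eq_left hh]
    nlinarith [sq_nonneg ((z : ℂ).re - h)]
  · rw [min_eq_right hh]
    nlinarith [mul_nonneg (sub_nonneg.2 h1) (sub_nonneg.2 hh), sq_nonneg ((z : ℂ).re - 1)]

theorem continuous_anisotropy (h : ℝ) : Continuous (anisotropy h) := by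
  unfold anisotropy
  have : Continuous fun z : Circle => (z : ℂ).re := Complex.continuous_re.comp continuous_subtype_val
  fun_prop

theorem abs_anisotropy_remainder_le (h a t : ℝ) :
    |anisotropy h (Circle.exp (a + t)) - anisotropy h (Circle.exp a) -
      Real.sin a * (h - Real.cos a) * t| ≤ (2 + |h|) * t ^ 2 := by
  have h1 := abs_cos_remainder_le a t
  have h2 := abs_cos_add_sub_cos_le a t
  rw [anisotropy_exp, anisotropy_exp]
  set r := Real.cos (a + t) - Real.cos a + Real.sin a * t with hr
  set d := Real.cos (a + t) - Real.cos a with hd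
  have e : (1 / 2) * (Real.cos (a + t) ^ 2 - 2 * h * Real.cos (a + t) + 2 * h * min h 1 -
      (min h 1) ^ 2) - (1 / 2) * (Real.cos a ^ 2 - 2 * h * Real.cos a + 2 * h * min h 1 -
      (min h 1) ^ 2) - Real.sin a * (h - Real.cos a) * t = (Real.cos a - h) * r + d ^ 2 / 2 := by
    rw [hr, hd]; ring
  rw [e]
  have h3 : |Real.cos a - h| ≤ 1 + |h| := (abs_sub _ _).trans (by
    gcongr; exact Real.abs_cos_le_one a)
  have h4 : d ^ 2 ≤ t ^ 2 := sq_le_sq.2 h2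
  calc |(Real.cos a - h) * r + d ^ 2 / 2| ≤ |(Real.cos a - h) * r| + |d ^ 2 / 2| := abs_add_le _ _
    _ = |Real.cos a - h| * |r| + d ^ 2 / 2 := by
        rw [abs_mul, abs_of_nonneg (by positivity : 0 ≤ d ^ 2 / 2)]
    _ ≤ (1 + |h|) * t ^ 2 + t ^ 2 / 2 := by gcongr
    _ ≤ _ := by nlinarith [sq_nonneg t]

/-- The map `e^{iφ}` has finite energy: `p = φ'` is square-integrable, `W(e^{iφ})` is integrable,
and `G` is the stray field of `e^{iφ}`, whose Neumann datum comes from `(cos φ)' = -sin φ p`. -/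
structure IsConfig (h : ℝ) (φ p : ℝ → ℝ) (G : L2Field) : Prop where
  prim : IsPrimitive φ p
  memLp : MemLp p 2
  integrable : Integrable fun x => anisotropy h (Circle.exp (φ x))
  neumann : IsNeumann (fun x => -Real.sin (φ x) * p x) G

/-- An admissible variation of the phase: a compactly supported function in `H¹(ℝ)`, together
with its derivative. -/
structure IsVariation (ψ q : ℝ → ℝ) : Prop where
  prim : IsPrimitive ψ q
  supp : HasCompactSupport ψ
  memLp : MemLp q 2

theorem IsPrimitive.isNeumann_iff {φ p : ℝ → ℝ} (hφ : IsPrimitive φ p) {m : ℝ → Circle}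
    (hm : ∀ᵐ x, m x = Circle.exp (φ x)) (G : L2Field) :
    IsStrayField m G ↔ IsNeumann (fun x => -Real.sin (φ x) * p x) G :=
  ⟨fun h => IsNeumann.congr_ae h (weakDeriv_re_ae_eq hφ hm),
    fun h => IsNeumann.congr_ae h (weakDeriv_re_ae_eq hφ hm).symm⟩

theorem lintegral_energy_density {φ p : ℝ → ℝ} (hφ : IsPrimitive φ p) {m : ℝ → Circle}
    (hm : ∀ᵐ x, m x = Circle.exp (φ x)) (h : ℝ) :
    ∫⁻ x, ENNReal.ofReal (‖weakDeriv m x‖ ^ 2 + 2 * anisotropy h (m x)) =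
      ∫⁻ x, ENNReal.ofReal (p x ^ 2 + 2 * anisotropy h (Circle.exp (φ x))) := by
  apply lintegral_congr_ae
  filter_upwards [norm_weakDeriv_sq_ae_eq hφ hm, hm] with x h1 h2
  rw [h1, h2]

theorem IsPrimitive.continuous_anisotropy {φ p : ℝ → ℝ} (hφ : IsPrimitive φ p) (h : ℝ) :
    Continuous fun x => anisotropy h (Circle.exp (φ x)) :=
  (NeelWall.continuous_anisotropy h).comp (Circle.exp.continuous.comp hφ.continuous)

theorem exists_isConfig {h : ℝ} {φ p : ℝ → ℝ} (hφ : IsPrimitive φ p) {m : ℝ → Circle}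
    (hm : ∀ᵐ x, m x = Circle.exp (φ x)) (hE : energy h m < ⊤) : ∃ G, IsConfig h φ p G := by
  have h1 : strayDirichlet m < ⊤ := by
    by_contra hne
    rw [not_lt_top_iff] at hne
    simp [energy, hne, ENNReal.mul_top] at hE
  have h2 : ∫⁻ x, ENNReal.ofReal (p x ^ 2 + 2 * anisotropy h (Circle.exp (φ x))) < ⊤ := by
    rw [← lintegral_energy_density hφ hm h]
    by_contra hne
    rw [not_lt_top_iff] at hne
    simp [energy, hne, ENNReal.mul_top] at hE
  obtain ⟨G, hG⟩ := exists_isStrayField h1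
  have hpm : AEStronglyMeasurable p volume := hφ.1.aestronglyMeasurable
  have hwc := hφ.continuous_anisotropy h
  have hint : Integrable (fun x => p x ^ 2 + 2 * anisotropy h (Circle.exp (φ x))) :=
    (lintegral_ofReal_ne_top_iff_integrable
      ((hpm.pow 2).add (hwc.aestronglyMeasurable.const_mul 2))
      (.of_forall fun x => by
        have := anisotropy_nonneg h (Circle.exp (φ x))
        change 0 ≤ p x ^ 2 + 2 * anisotropy h (Circle.exp (φ x))
        positivity)).1 h2.ne
  refine ⟨G, hφ, ?_, ?_, (hφ.isNeumann_iff hm G).1 hG⟩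
  · rw [memLp_two_iff_integrable_sq hpm]
    refine hint.mono' (hpm.pow 2) (.of_forall fun x => ?_)
    have := anisotropy_nonneg h (Circle.exp (φ x))
    rw [Real.norm_of_nonneg (sq_nonneg _)]
    linarith
  · refine hint.mono' hwc.aestronglyMeasurable (.of_forall fun x => ?_)
    have := anisotropy_nonneg h (Circle.exp (φ x))
    rw [Real.norm_of_nonneg this]
    nlinarith [sq_nonneg (p x)]

namespace IsConfig

variable {h : ℝ} {φ p : ℝ → ℝ} {G : L2Field}

theorem energy_toReal (hc : IsConfig h φ p G) {m : ℝ → Circle}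
    (hm : ∀ᵐ x, m x = Circle.exp (φ x)) :
    (energy h m).toReal = (1 / 2) * (∫ x, p x ^ 2) +
      (∫ x, anisotropy h (Circle.exp (φ x))) + (1 / 2) * ‖G‖ ^ 2 := by
  have hi := hc.memLp.integrable_sq.add (hc.integrable.const_mul 2)
  have hnn : ∀ x, 0 ≤ p x ^ 2 + 2 * anisotropy h (Circle.exp (φ x)) := fun x => by
    have := anisotropy_nonneg h (Circle.exp (φ x))
    positivity
  rw [energy, lintegral_energy_density hc.prim hm h,
    strayDirichlet_eq ((hc.prim.isNeumann_iff hm G).2 hc.neumann)]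
  have e : ∫⁻ x, ENNReal.ofReal (p x ^ 2 + 2 * anisotropy h (Circle.exp (φ x))) =
      ENNReal.ofReal ((∫ x, p x ^ 2) + 2 * ∫ x, anisotropy h (Circle.exp (φ x))) := by
    rw [← integral_const_mul, ← integral_add hc.memLp.integrable_sq (hc.integrable.const_mul 2)]
    exact (ofReal_integral_eq_lintegral_ofReal hi (.of_forall hnn)).symm
  have e0 : 0 ≤ (∫ x, p x ^ 2) + 2 * ∫ x, anisotropy h (Circle.exp (φ x)) := by
    have h1 : 0 ≤ ∫ x, p x ^ 2 := integral_nonneg fun x => sq_nonneg _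
    have h2 : 0 ≤ ∫ x, anisotropy h (Circle.exp (φ x)) :=
      integral_nonneg fun x => anisotropy_nonneg h _
    linarith
  rw [e, ENNReal.toReal_add (by finiteness) (by finiteness), ENNReal.toReal_mul,
    ENNReal.toReal_mul, ENNReal.toReal_ofReal e0, ENNReal.toReal_ofReal (sq_nonneg _)]
  simp
  ring

end IsConfig

open Classical in
/-- The Neumann field of the datum `q`, or `0` if there is none. -/
def neumannField (q : ℝ → ℝ) : L2Field := if h : ∃ G, IsNeumann q G then h.choose else 0

theorem IsNeumann.neumannField_eq {q : ℝ → ℝ} {G : L2Field} (h : IsNeumann q G) :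
    neumannField q = G := by
  have hex : ∃ G, IsNeumann q G := ⟨G, h⟩
  rw [neumannField, dif_pos hex]
  exact hex.choose_spec.unique h

namespace IsVariation

variable {ψ q ψ' q' φ p : ℝ → ℝ}

theorem memLp_fun (hv : IsVariation ψ q) : MemLp ψ 2 :=
  hv.prim.continuous.memLp_of_hasCompactSupport hv.supp

theorem sub (hv : IsVariation ψ q) (hv' : IsVariation ψ' q') :
    IsVariation (fun x => ψ x - ψ' x) (fun x => q x - q' x) :=
  ⟨hv.prim.sub hv'.prim, hv.supp.sub hv'.supp, hv.memLp.sub hv'.memLp⟩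

theorem const_mul (hv : IsVariation ψ q) (c : ℝ) :
    IsVariation (fun x => c * ψ x) (fun x => c * q x) :=
  ⟨hv.prim.const_mul c, hv.supp.mul_left, hv.memLp.const_mul c⟩

theorem of_isTest {ζ : ℝ → ℝ} (h : IsTest ζ) : IsVariation ζ (deriv ζ) :=
  ⟨.of_contDiff (h.1.of_le (by simp)), h.2,
    (h.1.continuous_deriv (by simp)).memLp_of_hasCompactSupport h.2.deriv⟩

theorem exists_bound (hv : IsVariation ψ q) : ∃ B, 0 ≤ B ∧ ∀ x, |ψ x| ≤ B := by
  obtain ⟨B, hB⟩ := hv.supp.exists_bound_of_continuous hv.prim.continuous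
  exact ⟨B, (norm_nonneg _).trans (hB 0), hB⟩

end IsVariation

/-! ### Expansion of the energy along a variation of the phase -/

theorem memLp_two_and_integral_sq_le {u p q : ℝ → ℝ} (hu : AEStronglyMeasurable u)
    (hp : MemLp p 2) (hq : MemLp q 2) {a b : ℝ} (h : ∀ x, u x ^ 2 ≤ a * p x ^ 2 + b * q x ^ 2) :
    MemLp u 2 ∧ ∫ x, u x ^ 2 ≤ a * (∫ x, p x ^ 2) + b * ∫ x, q x ^ 2 := by
  have hi := (hp.integrable_sq.const_mul a).add (hq.integrable_sq.const_mul b)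
  have hu2 : Integrable fun x => u x ^ 2 := by
    refine hi.mono' (hu.pow 2) (.of_forall fun x => ?_)
    rw [Real.norm_of_nonneg (sq_nonneg _)]
    exact h x
  refine ⟨(memLp_two_iff_integrable_sq hu).2 hu2, ?_⟩
  rw [← integral_const_mul, ← integral_const_mul,
    ← integral_add (hp.integrable_sq.const_mul a) (hq.integrable_sq.const_mul b)]
  exact integral_mono hu2 hi h

namespace IsVariation

variable {ψ q φ p : ℝ → ℝ} {B : ℝ}

theorem cos_add_sub_cos (hv : IsVariation ψ q) (hφ : IsPrimitive φ p) (hp : MemLp p 2)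
    (hB : ∀ x, |ψ x| ≤ B) :
    IsVariation (fun x => Real.cos (φ x + ψ x) - Real.cos (φ x))
        (fun x => -Real.sin (φ x + ψ x) * (p x + q x) - -Real.sin (φ x) * p x) ∧
      ∫ x, (-Real.sin (φ x + ψ x) * (p x + q x) - -Real.sin (φ x) * p x) ^ 2 ≤
        2 * B ^ 2 * (∫ x, p x ^ 2) + 2 * ∫ x, q x ^ 2 := by
  have hprim := (hφ.add hv.prim).cos.sub hφ.cos
  have := memLp_two_and_integral_sq_le hprim.1.aestronglyMeasurable hp hv.memLp
    (a := 2 * B ^ 2) (b := 2) fun x => by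
      have h1 := sq_le_sq.2 ((abs_sin_add_sub_sin_le (φ x) (ψ x)).trans
        ((hB x).trans (le_abs_self B)))
      have h2 := Real.sin_sq_le_one (φ x + ψ x)
      set S := Real.sin (φ x + ψ x)
      set T := Real.sin (φ x)
      calc (-S * (p x + q x) - -T * p x) ^ 2
          ≤ 2 * ((S - T) ^ 2 * p x ^ 2) + 2 * (S ^ 2 * q x ^ 2) := by
            nlinarith [sq_nonneg ((S - T) * p x - S * q x)]
        _ ≤ 2 * (B ^ 2 * p x ^ 2) + 2 * (1 * q x ^ 2) := by gcongr
        _ = _ := by ring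
  refine ⟨⟨hprim, hv.supp.mono fun x hx hx' => hx ?_, this.1⟩, this.2⟩
  simp [hx']

theorem neg_sin_mul (hv : IsVariation ψ q) (hφ : IsPrimitive φ p) (hp : MemLp p 2)
    (hB : ∀ x, |ψ x| ≤ B) :
    IsVariation (fun x => -(Real.sin (φ x) * ψ x))
        (fun x => -(Real.cos (φ x) * p x * ψ x + Real.sin (φ x) * q x)) ∧
      ∫ x, (-(Real.cos (φ x) * p x * ψ x + Real.sin (φ x) * q x)) ^ 2 ≤
        2 * B ^ 2 * (∫ x, p x ^ 2) + 2 * ∫ x, q x ^ 2 := by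
  have hprim : IsPrimitive (fun x => -(Real.sin (φ x) * ψ x))
      (fun x => -(Real.cos (φ x) * p x * ψ x + Real.sin (φ x) * q x)) := by
    simpa using (hφ.sin.mul hv.prim).const_mul (-1)
  have := memLp_two_and_integral_sq_le hprim.1.aestronglyMeasurable hp hv.memLp
    (a := 2 * B ^ 2) (b := 2) fun x => by
      have h1 := sq_le_sq.2 ((hB x).trans (le_abs_self B))
      have h2 := Real.sin_sq_le_one (φ x)
      have h3 := Real.cos_sq_le_one (φ x)
      set S := Real.sin (φ x)
      set T := Real.cos (φ x)
      calc (-(T * p x * ψ x + S * q x)) ^ 2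
          ≤ 2 * (T ^ 2 * ψ x ^ 2 * p x ^ 2) + 2 * (S ^ 2 * q x ^ 2) := by
            nlinarith [sq_nonneg (T * p x * ψ x - S * q x)]
        _ ≤ 2 * (1 * B ^ 2 * p x ^ 2) + 2 * (1 * q x ^ 2) := by gcongr
        _ = _ := by ring
  refine ⟨⟨hprim, hv.supp.mono fun x hx hx' => hx ?_, this.1⟩, this.2⟩
  simp [hx']

/-- Bound for the derivative of the second-order remainder `cos (φ + ψ) - cos φ + ψ sin φ` of the
first component. The coefficient of `∫ q²` is `B²`, not merely a constant, so that this term can be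
absorbed for small `B`. -/
theorem integral_sq_remainder_le (hv : IsVariation ψ q) (hφ : IsPrimitive φ p) (hp : MemLp p 2)
    (hB : ∀ x, |ψ x| ≤ B) :
    ∫ x, (-Real.sin (φ x + ψ x) * (p x + q x) - -Real.sin (φ x) * p x -
      -(Real.cos (φ x) * p x * ψ x + Real.sin (φ x) * q x)) ^ 2 ≤
        2 * B ^ 4 * (∫ x, p x ^ 2) + 2 * B ^ 2 * ∫ x, q x ^ 2 := by
  refine (memLp_two_and_integral_sq_le ((hv.cos_add_sub_cos hφ hp hB).1.prim.1.sub
    (hv.neg_sin_mul hφ hp hB).1.prim.1).aestronglyMeasurable hp hv.memLp fun x => ?_).2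
  have h0 := sq_le_sq.2 ((hB x).trans (le_abs_self B))
  have h1 := sq_le_sq.2 ((abs_sin_add_sub_sin_le (φ x) (ψ x)).trans
    ((hB x).trans (le_abs_self B)))
  have h2 := sq_le_sq.2 ((abs_sin_remainder_le (φ x) (ψ x)).trans (h0.trans (le_abs_self _)))
  set S := Real.sin (φ x + ψ x)
  set T := Real.sin (φ x)
  set C := Real.cos (φ x)
  have e : (B ^ 2) ^ 2 = B ^ 4 := by ring
  simp only [Pi.sub_apply]
  calc (-S * (p x + q x) - -T * p x - -(C * p x * ψ x + T * q x)) ^ 2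
      ≤ 2 * ((S - T - C * ψ x) ^ 2 * p x ^ 2) + 2 * ((S - T) ^ 2 * q x ^ 2) := by
        nlinarith [sq_nonneg ((S - T - C * ψ x) * p x - (S - T) * q x)]
    _ ≤ 2 * ((B ^ 2) ^ 2 * p x ^ 2) + 2 * (B ^ 2 * q x ^ 2) := by gcongr
    _ = _ := by rw [e]; ring

theorem exists_isNeumann (hv : IsVariation ψ q) : ∃ G, IsNeumann q G :=
  NeelWall.exists_isNeumann hv.prim hv.memLp_fun hv.memLp

theorem isNeumann_neumannField (hv : IsVariation ψ q) : IsNeumann q (neumannField q) := by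
  obtain ⟨G, hG⟩ := hv.exists_isNeumann
  rwa [hG.neumannField_eq]

end IsVariation

/-- The first variation of the energy at the phase `φ` (with `p = φ'` and stray field `G`) in the
direction `ψ` (with `q = ψ'`). The last term pairs `G` with the stray field generated by the
linearization `-ψ sin φ` of `cos (φ + ψ)`. -/
def firstVariation (h : ℝ) (φ p : ℝ → ℝ) (G : L2Field) (ψ q : ℝ → ℝ) : ℝ :=
  (∫ x, p x * q x) + (∫ x, Real.sin (φ x) * (h - Real.cos (φ x)) * ψ x) +
    inner ℝ G (neumannField fun x => -(Real.cos (φ x) * p x * ψ x + Real.sin (φ x) * q x))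

namespace IsConfig

variable {h B : ℝ} {φ p ψ q : ℝ → ℝ} {G : L2Field}

/-- The expansion of the energy along a variation: apart from the first variation and the
nonnegative terms `½ ∫ q²` and `D`, only a quadratic remainder `R` of the anisotropy and a
remainder `S` occur. Here `D` is the stray field energy of the increment `cos (φ + ψ) - cos φ`, and
`S` pairs `G` with the stray field of its second-order part; `δ` is the parameter of the
interpolation bound `IsNeumann.norm_sq_le`. -/
theorem expansion (hc : IsConfig h φ p G) (hv : IsVariation ψ q) (hB : ∀ x, |ψ x| ≤ B) :
    ∃ (G' : L2Field) (R D S : ℝ),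
      IsConfig h (fun x => φ x + ψ x) (fun x => p x + q x) G' ∧
      (1 / 2) * (∫ x, (p x + q x) ^ 2) + (∫ x, anisotropy h (Circle.exp (φ x + ψ x))) +
        (1 / 2) * ‖G'‖ ^ 2 =
      (1 / 2) * (∫ x, p x ^ 2) + (∫ x, anisotropy h (Circle.exp (φ x))) + (1 / 2) * ‖G‖ ^ 2 +
        firstVariation h φ p G ψ q + (1 / 2) * (∫ x, q x ^ 2) + R + D + S ∧
      |R| ≤ (2 + |h|) * (∫ x, ψ x ^ 2) ∧ 0 ≤ D ∧
      D ≤ (∫ x, ψ x ^ 2) + B ^ 2 * (∫ x, p x ^ 2) + ∫ x, q x ^ 2 ∧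
      ∀ δ, 0 < δ → S ^ 2 ≤ ‖G‖ ^ 2 * ((1 / δ) * (B ^ 2 * ∫ x, ψ x ^ 2) +
        δ * (2 * B ^ 4 * (∫ x, p x ^ 2) + 2 * B ^ 2 * ∫ x, q x ^ 2)) := by
  obtain ⟨hd, hd'⟩ := hv.cos_add_sub_cos hc.prim hc.memLp hB
  obtain ⟨he, he'⟩ := hv.neg_sin_mul hc.prim hc.memLp hB
  have hr' := hv.integral_sq_remainder_le hc.prim hc.memLp hB
  have hr := hd.sub he
  obtain ⟨Gd, hGd⟩ := hd.exists_isNeumann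
  obtain ⟨Ge, hGe⟩ := he.exists_isNeumann
  obtain ⟨Gr, hGr⟩ := hr.exists_isNeumann
  have hder : Gd = Ge + Gr := by
    refine hGd.unique ((hGe.add hGr he.prim.1 hr.prim.1).congr_ae (.of_forall fun x => ?_))
    simp
  have hG' : IsNeumann (fun x => -Real.sin (φ x + ψ x) * (p x + q x)) (G + Gd) :=
    (hc.neumann.add hGd hc.prim.cos.1 hd.prim.1).congr_ae (.of_forall fun x => by simp)
  have hrem : ∀ x, |anisotropy h (Circle.exp (φ x + ψ x)) - anisotropy h (Circle.exp (φ x)) -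
      Real.sin (φ x) * (h - Real.cos (φ x)) * ψ x| ≤ (2 + |h|) * ψ x ^ 2 := fun x =>
    abs_anisotropy_remainder_le h (φ x) (ψ x)
  have hiψ : Integrable fun x => (2 + |h|) * ψ x ^ 2 := hv.memLp_fun.integrable_sq.const_mul _
  have hsc : Continuous fun x => Real.sin (φ x) * (h - Real.cos (φ x)) := by
    have := hc.prim.continuous
    fun_prop
  have hil : Integrable fun x => Real.sin (φ x) * (h - Real.cos (φ x)) * ψ x :=
    (hsc.mul hv.prim.continuous).integrable_of_hasCompactSupport hv.supp.mul_left
  have hirem : Integrable fun x => anisotropy h (Circle.exp (φ x + ψ x)) -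
      anisotropy h (Circle.exp (φ x)) - Real.sin (φ x) * (h - Real.cos (φ x)) * ψ x := by
    refine hiψ.mono' ?_ (.of_forall hrem)
    exact ((((hc.prim.add hv.prim).continuous_anisotropy h).sub
      (hc.prim.continuous_anisotropy h)).sub (hsc.mul hv.prim.continuous)).aestronglyMeasurable
  have hisum : Integrable fun x => anisotropy h (Circle.exp (φ x + ψ x)) := by
    refine ((hirem.add hil).add hc.integrable).congr (.of_forall fun x => ?_)
    simp
  refine ⟨G + Gd, ∫ x, (anisotropy h (Circle.exp (φ x + ψ x)) - anisotropy h (Circle.exp (φ x)) -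
      Real.sin (φ x) * (h - Real.cos (φ x)) * ψ x), (1 / 2) * ‖Gd‖ ^ 2, inner ℝ G Gr,
    ⟨hc.prim.add hv.prim, hc.memLp.add hv.memLp, hisum, hG'⟩, ?_, ?_, by positivity, ?_, ?_⟩
  · have e1 : ∫ x, (p x + q x) ^ 2 =
        (∫ x, p x ^ 2) + 2 * (∫ x, p x * q x) + ∫ x, q x ^ 2 := by
      have hpq : Integrable fun x => p x * q x := hc.memLp.integrable_mul hv.memLp
      have hs : Integrable fun x => p x ^ 2 + 2 * (p x * q x) :=
        hc.memLp.integrable_sq.add (hpq.const_mul 2)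
      rw [← integral_const_mul, ← integral_add hc.memLp.integrable_sq (hpq.const_mul 2),
        ← integral_add hs hv.memLp.integrable_sq]
      congr 1
      ext x
      ring
    have e2 : ∫ x, (anisotropy h (Circle.exp (φ x + ψ x)) - anisotropy h (Circle.exp (φ x)) -
        Real.sin (φ x) * (h - Real.cos (φ x)) * ψ x) =
        (∫ x, anisotropy h (Circle.exp (φ x + ψ x))) - (∫ x, anisotropy h (Circle.exp (φ x))) -
        ∫ x, Real.sin (φ x) * (h - Real.cos (φ x)) * ψ x := by
      have hs : Integrable fun x => anisotropy h (Circle.exp (φ x + ψ x)) -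
          anisotropy h (Circle.exp (φ x)) := hisum.sub hc.integrable
      rw [← integral_sub hisum hc.integrable, ← integral_sub hs hil]
    have e3 : ‖G + Gd‖ ^ 2 = ‖G‖ ^ 2 + 2 * (inner ℝ G Ge + inner ℝ G Gr) + ‖Gd‖ ^ 2 := by
      rw [norm_add_sq_real, ← inner_add_right, ← hder]
    rw [e1, e2, e3, firstVariation, hGe.neumannField_eq]
    ring
  · refine (abs_integral_le_integral_abs).trans ?_
    rw [← integral_const_mul]
    exact integral_mono hirem.abs hiψ hrem
  · have h1 := hGd.norm_sq_le hd.prim hd.memLp_fun hd.memLp one_pos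
    have h2 : ∫ x, (Real.cos (φ x + ψ x) - Real.cos (φ x)) ^ 2 ≤ ∫ x, ψ x ^ 2 :=
      integral_mono hd.memLp_fun.integrable_sq hv.memLp_fun.integrable_sq fun x =>
        sq_le_sq.2 (abs_cos_add_sub_cos_le _ _)
    have h3 : 0 ≤ ∫ x, ψ x ^ 2 := integral_nonneg fun x => sq_nonneg _
    linarith
  · intro δ hδ
    have h1 := hGr.norm_sq_le hr.prim hr.memLp_fun hr.memLp hδ
    have h2 : ∫ x, (Real.cos (φ x + ψ x) - Real.cos (φ x) - -(Real.sin (φ x) * ψ x)) ^ 2 ≤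
        B ^ 2 * ∫ x, ψ x ^ 2 := by
      rw [← integral_const_mul]
      refine integral_mono hr.memLp_fun.integrable_sq
        (hv.memLp_fun.integrable_sq.const_mul _) fun x => ?_
      have h3 := abs_cos_remainder_le (φ x) (ψ x)
      have h4 : ψ x ^ 2 ≤ |B| * |ψ x| := by
        rw [← sq_abs, sq]
        exact mul_le_mul_of_nonneg_right ((hB x).trans (le_abs_self B)) (abs_nonneg _)
      have h5 := pow_le_pow_left₀ (abs_nonneg _) (h3.trans h4) 2
      rw [sq_abs, mul_pow, sq_abs, sq_abs] at h5
      convert h5 using 2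
      ring
    have h3 : (inner ℝ G Gr) ^ 2 ≤ ‖G‖ ^ 2 * ‖Gr‖ ^ 2 := by
      rw [← mul_pow]
      exact sq_le_sq.2 ((abs_real_inner_le_norm G Gr).trans (le_abs_self _))
    refine h3.trans ?_
    gcongr
    refine h1.trans ?_
    gcongr

end IsConfig

/-! ### Vanishing of the first variation -/

/-- A compactly supported `H¹` function is the limit in `H¹` of test functions with supports in a
common compact set. -/
theorem IsVariation.exists_isTest_approx {ψ q : ℝ → ℝ} (hv : IsVariation ψ q) {A : ℝ}
    (hA : 0 ≤ A) (hψ : ∀ x, A < |x| → ψ x = 0) :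
    ∃ K, 0 ≤ K ∧ ∀ ε, 0 < ε → ∃ ζ, IsTest ζ ∧ (∀ x, A + 1 < |x| → ζ x = 0) ∧
      ∫ x, (q x - deriv ζ x) ^ 2 ≤ K * ε ^ 2 := by
  let χ : ContDiffBump (0 : ℝ) := ⟨A + 1 / 2, A + 1, by linarith, by linarith⟩
  have hχ0 : ∀ x, A + 1 < |x| → χ x = 0 := fun x hx =>
    χ.zero_of_le_dist (by simpa [Real.dist_eq] using hx.le)
  have hχ1 : ∀ x, |x| ≤ A → χ x = 1 := fun x hx =>
    χ.one_of_mem_closedBall (by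
      rw [mem_closedBall_zero_iff, Real.norm_eq_abs]
      exact hx.trans (by change A ≤ A + 1 / 2; linarith))
  set b := χ.normed volume with hb
  have hb0 : ∀ x, A + 1 < |x| → b x = 0 := fun x hx => by
    simp [hb, ContDiffBump.normed, hχ0 x hx]
  have hbc : ContDiff ℝ ∞ b := χ.contDiff_normed
  have hb2 : MemLp b 2 := hbc.continuous.memLp_of_hasCompactSupport χ.hasCompactSupport_normed
  have hb1 : ∫ x, b x = 1 := χ.integral_normed
  have hN : 0 ≤ ∫ x, b x ^ 2 := integral_nonneg fun x => sq_nonneg _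
  refine ⟨2 + 4 * (A + 1) * ∫ x, b x ^ 2, by positivity, fun ε hε => ?_⟩
  obtain ⟨g, hgs, hgc, hg⟩ := hv.memLp.exist_eLpNorm_sub_le (by simp) (by simp) hε
  have hg2 : MemLp g 2 := hgc.continuous.memLp_of_hasCompactSupport hgs
  have hqg : MemLp (fun x => q x - g x) 2 := hv.memLp.sub hg2
  have hqg2 : ∫ x, (q x - g x) ^ 2 ≤ ε ^ 2 := integral_sq_le_of_eLpNorm_le hqg hε.le hg
  have hq0 : ∀ᵐ x, A < |x| → q x = 0 := by
    filter_upwards [hv.prim.ae_eq_zero_of_notMem (K := {x | |x| ≤ A})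
      (isClosed_le continuous_abs continuous_const) (fun x hx => hψ x (not_le.1 hx))] with x hx hx'
    exact hx (not_le.2 hx')
  have hχg : MemLp (fun x => χ x * g x) 2 :=
    (χ.continuous.mul hgc.continuous).memLp_of_hasCompactSupport hgs.mul_left
  have hdm : MemLp (fun x => q x - χ x * g x) 2 := hv.memLp.sub hχg
  have hd2 : ∫ x, (q x - χ x * g x) ^ 2 ≤ ε ^ 2 := by
    refine le_trans (integral_mono_ae hdm.integrable_sq hqg.integrable_sq ?_) hqg2
    filter_upwards [hq0] with x hx
    have e : q x - χ x * g x = χ x * (q x - g x) := by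
      by_cases h : |x| ≤ A
      · rw [hχ1 x h]; ring
      · rw [hx (not_le.1 h)]; ring
    rw [e, mul_pow]
    have h1 : χ x ^ 2 ≤ 1 := pow_le_one₀ χ.nonneg χ.le_one
    nlinarith [sq_nonneg (q x - g x)]
  have hzero : ∀ᵐ x, x ∉ Icc (-(A + 1)) (A + 1) → q x - χ x * g x = 0 := by
    filter_upwards [hq0] with x hx hx'
    have : A + 1 < |x| := by
      by_contra h
      exact hx' (abs_le.1 (not_lt.1 h))
    rw [hx (by linarith), hχ0 x this]
    ring
  -- the mean of the approximation is small and is corrected by a multiple of `b`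
  set c := ∫ x, χ x * g x with hc
  have hqi : ∫ x, q x = 0 := hv.prim.integral_eq_zero hv.supp
  have hqint : Integrable q := by
    have hK : IsCompact (Icc (-A) A) := isCompact_Icc
    have h1 : IntegrableOn q (Icc (-A) A) := hv.prim.1.integrableOn_isCompact hK
    refine h1.integrable_of_ae_notMem_eq_zero ?_
    filter_upwards [hq0] with x hx hx'
    apply hx
    by_contra h
    exact hx' (abs_le.1 (not_lt.1 h))
  have hχgi : Integrable fun x => χ x * g x :=
    (χ.continuous.mul hgc.continuous).integrable_of_hasCompactSupport hgs.mul_left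
  have hc2 : c ^ 2 ≤ 2 * (A + 1) * ε ^ 2 := by
    have e1 : ∫ x, (q x - χ x * g x) = -c := by
      rw [integral_sub hqint hχgi, hqi, hc]
      ring
    have e2 : ∫ x in (-(A + 1))..(A + 1), (q x - χ x * g x) = -c := by
      rw [intervalIntegral.integral_of_le (by linarith), ← integral_Icc_eq_integral_Ioc,
        setIntegral_eq_integral_of_ae_compl_eq_zero hzero, e1]
    have h1 := sq_intervalIntegral_le hdm (a := -(A + 1)) (b := A + 1) (by linarith)
    rw [e2, neg_sq] at h1
    have h2 : ∫ x in Icc (-(A + 1)) (A + 1), (q x - χ x * g x) ^ 2 ≤ ε ^ 2 :=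
      (setIntegral_le_integral hdm.integrable_sq (.of_forall fun x => sq_nonneg _)).trans hd2
    calc c ^ 2 ≤ (A + 1 - -(A + 1)) * ∫ x in Icc (-(A + 1)) (A + 1), (q x - χ x * g x) ^ 2 := h1
      _ ≤ (A + 1 - -(A + 1)) * ε ^ 2 := by
          gcongr
          linarith
      _ = _ := by ring
  obtain ⟨ζ, hζ, hζd, hζ0⟩ := exists_isTest_deriv_eq (u := fun x => χ x * g x - c * b x)
    (A := A + 1) ((χ.contDiff.mul hgc).sub (contDiff_const.mul hbc)) (by linarith)
    (fun x hx => by simp [hχ0 x hx, hb0 x hx])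
    (by
      rw [integral_sub hχgi (χ.integrable_normed.const_mul c), integral_const_mul, hb1, hc]
      ring)
  refine ⟨ζ, hζ, hζ0, ?_⟩
  rw [hζd]
  have h1 := (memLp_two_and_integral_sq_le (u := fun x => q x - (χ x * g x - c * b x))
    (hdm.aestronglyMeasurable.add (hb2.aestronglyMeasurable.const_mul c) |>.congr
      (.of_forall fun x => by simp; ring)) hdm hb2 (a := 2) (b := 2 * c ^ 2) (fun x => by
      nlinarith [sq_nonneg (q x - χ x * g x - c * b x)])).2
  refine h1.trans ?_
  nlinarith

namespace IsConfig

variable {h : ℝ} {φ p ψ q ψ' q' : ℝ → ℝ} {G : L2Field}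

theorem isNeumann_linearized (hc : IsConfig h φ p G) (hv : IsVariation ψ q) :
    IsNeumann (fun x => -(Real.cos (φ x) * p x * ψ x + Real.sin (φ x) * q x))
      (neumannField fun x => -(Real.cos (φ x) * p x * ψ x + Real.sin (φ x) * q x)) := by
  obtain ⟨B, -, hB⟩ := hv.exists_bound
  exact (hv.neg_sin_mul hc.prim hc.memLp hB).1.isNeumann_neumannField

theorem integrable_linear (hc : IsConfig h φ p G) (hv : IsVariation ψ q) :
    Integrable fun x => Real.sin (φ x) * (h - Real.cos (φ x)) * ψ x := by
  have hsc : Continuous fun x => Real.sin (φ x) * (h - Real.cos (φ x)) := by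
    have := hc.prim.continuous
    fun_prop
  exact (hsc.mul hv.prim.continuous).integrable_of_hasCompactSupport hv.supp.mul_left

theorem firstVariation_const_mul (hc : IsConfig h φ p G) (hv : IsVariation ψ q) (c : ℝ) :
    firstVariation h φ p G (fun x => c * ψ x) (fun x => c * q x) =
      c * firstVariation h φ p G ψ q := by
  have hn := ((hc.isNeumann_linearized hv).smul c).congr_ae
    (q' := fun x => -(Real.cos (φ x) * p x * (c * ψ x) + Real.sin (φ x) * (c * q x)))
    (.of_forall fun x => by ring)
  rw [firstVariation, firstVariation, hn.neumannField_eq, real_inner_smul_right, mul_add, mul_add,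
    ← integral_const_mul, ← integral_const_mul]
  congr 2
  · congr 1; ext x; ring
  · congr 1; ext x; ring

theorem firstVariation_sub (hc : IsConfig h φ p G) (hv : IsVariation ψ q)
    (hv' : IsVariation ψ' q') :
    firstVariation h φ p G (fun x => ψ x - ψ' x) (fun x => q x - q' x) =
      firstVariation h φ p G ψ q - firstVariation h φ p G ψ' q' := by
  obtain ⟨B, -, hB⟩ := hv.exists_bound
  obtain ⟨B', -, hB'⟩ := hv'.exists_bound
  have hl := (hv.neg_sin_mul hc.prim hc.memLp hB).1.prim.1
  have hl' := (hv'.neg_sin_mul hc.prim hc.memLp hB').1.prim.1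
  have hn := ((hc.isNeumann_linearized hv).add ((hc.isNeumann_linearized hv').smul (-1)) hl
    (hl'.smul (-1 : ℝ))).congr_ae
    (q' := fun x => -(Real.cos (φ x) * p x * (ψ x - ψ' x) + Real.sin (φ x) * (q x - q' x)))
    (.of_forall fun x => by ring)
  have i1 : Integrable fun x => p x * q x := hc.memLp.integrable_mul hv.memLp
  have i2 : Integrable fun x => p x * q' x := hc.memLp.integrable_mul hv'.memLp
  rw [firstVariation, firstVariation, firstVariation, hn.neumannField_eq, inner_add_right,
    real_inner_smul_right]
  simp only [mul_sub (p _), mul_sub (Real.sin _ * _)]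
  rw [integral_sub i1 i2, integral_sub (hc.integrable_linear hv) (hc.integrable_linear hv')]
  ring

/-- The first variation is bounded in `H¹` on functions with support in a fixed interval. -/
theorem exists_firstVariation_bound (hc : IsConfig h φ p G) {A : ℝ} (hA : 0 ≤ A) :
    ∃ C, ∀ ψ q, IsVariation ψ q → (∀ x, A < |x| → ψ x = 0) →
      firstVariation h φ p G ψ q ^ 2 ≤ C * ∫ x, q x ^ 2 := by
  set P := ∫ x, p x ^ 2 with hP
  have hP0 : 0 ≤ P := integral_nonneg fun x => sq_nonneg _
  refine ⟨3 * (P + (1 + |h|) ^ 2 * (2 * (A + 1)) * (2 * (A + 1) * (2 * (A + 1))) +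
    ‖G‖ ^ 2 * ((2 * (A + 1)) * (2 * (A + 1)) + (2 * (2 * (A + 1)) * P + 2))),
    fun ψ q hv hψ => ?_⟩
  set L := 2 * (A + 1) with hL
  have hL0 : 0 ≤ L := by rw [hL]; linarith
  set Q := ∫ x, q x ^ 2 with hQ
  have hQ0 : 0 ≤ Q := integral_nonneg fun x => sq_nonneg _
  have hψ2 : ∀ x, ψ x ^ 2 ≤ L * Q := by
    intro x
    by_cases hx : A < |x|
    · rw [hψ x hx]; simp; positivity
    · have hx' := abs_le.1 (not_lt.1 hx)
      have h1 := hv.prim.2 (-(A + 1)) x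
      rw [hψ (-(A + 1)) (by rw [abs_neg, abs_of_nonneg] <;> linarith), sub_zero] at h1
      rw [← h1]
      refine (sq_intervalIntegral_le hv.memLp (by linarith)).trans ?_
      have h2 : ∫ t in Icc (-(A + 1)) x, q t ^ 2 ≤ Q :=
        setIntegral_le_integral hv.memLp.integrable_sq (.of_forall fun x => sq_nonneg _)
      have h3 : 0 ≤ ∫ t in Icc (-(A + 1)) x, q t ^ 2 := integral_nonneg fun x => sq_nonneg _
      have h4 : x - -(A + 1) ≤ L := by rw [hL]; linarith
      exact mul_le_mul h4 h2 h3 hL0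
  have hB : ∀ x, |ψ x| ≤ √(L * Q) := fun x => Real.abs_le_sqrt (hψ2 x)
  have hB2 : √(L * Q) ^ 2 = L * Q := Real.sq_sqrt (by positivity)
  have hvol : ∫ x, ψ x ^ 2 ≤ L * (L * Q) := by
    have e : ∫ x, ψ x ^ 2 = ∫ x in Icc (-(A + 1)) (A + 1), ψ x ^ 2 := by
      refine (setIntegral_eq_integral_of_forall_compl_eq_zero fun x hx => ?_).symm
      rw [hψ x, sq, zero_mul]
      by_contra hle
      have := abs_le.1 (not_lt.1 hle)
      exact hx ⟨by linarith, by linarith⟩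
    rw [e]
    calc ∫ x in Icc (-(A + 1)) (A + 1), ψ x ^ 2
        ≤ ∫ x in Icc (-(A + 1)) (A + 1), L * Q :=
          integral_mono hv.memLp_fun.integrable_sq.integrableOn (integrable_const _) hψ2
      _ = L * (L * Q) := by
          rw [setIntegral_const, Measure.real, Real.volume_Icc, ENNReal.toReal_ofReal (by linarith),
            smul_eq_mul, hL]
          ring
  have t1 : (∫ x, p x * q x) ^ 2 ≤ P * Q := sq_integral_mul_le hc.memLp hv.memLp
  have t2 : (∫ x, Real.sin (φ x) * (h - Real.cos (φ x)) * ψ x) ^ 2 ≤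
      (1 + |h|) ^ 2 * L * (L * L) * Q := by
    have e : ∫ x, Real.sin (φ x) * (h - Real.cos (φ x)) * ψ x =
        ∫ x in Icc (-(A + 1)) (A + 1), Real.sin (φ x) * (h - Real.cos (φ x)) * ψ x := by
      refine (setIntegral_eq_integral_of_forall_compl_eq_zero fun x hx => ?_).symm
      rw [hψ x, mul_zero]
      by_contra hle
      have := abs_le.1 (not_lt.1 hle)
      exact hx ⟨by linarith, by linarith⟩
    have hb : |∫ x in Icc (-(A + 1)) (A + 1), Real.sin (φ x) * (h - Real.cos (φ x)) * ψ x| ≤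
        (1 + |h|) * √(L * Q) * L := by
      have := norm_setIntegral_le_of_norm_le_const (μ := volume) (s := Icc (-(A + 1)) (A + 1))
        (f := fun x => Real.sin (φ x) * (h - Real.cos (φ x)) * ψ x)
        (C := (1 + |h|) * √(L * Q)) (by simp) (fun x _ => by
          rw [Real.norm_eq_abs, abs_mul, abs_mul]
          have h1 := Real.abs_sin_le_one (φ x)
          have h2 : |h - Real.cos (φ x)| ≤ 1 + |h| := by
            rw [abs_sub_comm]
            exact (abs_sub _ _).trans (by gcongr; exact Real.abs_cos_le_one _)
          calc |Real.sin (φ x)| * |h - Real.cos (φ x)| * |ψ x|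
              ≤ 1 * (1 + |h|) * √(L * Q) := by gcongr; exact hB x
            _ = _ := by ring)
      rw [Measure.real, Real.volume_Icc, ENNReal.toReal_ofReal (by linarith)] at this
      rw [Real.norm_eq_abs] at this
      refine this.trans (le_of_eq ?_)
      rw [hL]; ring
    rw [e, ← sq_abs]
    calc _ ≤ ((1 + |h|) * √(L * Q) * L) ^ 2 := pow_le_pow_left₀ (abs_nonneg _) hb 2
      _ = _ := by rw [mul_pow, mul_pow, hB2]; ring
  have t3 : (inner ℝ G (neumannField fun x =>
      -(Real.cos (φ x) * p x * ψ x + Real.sin (φ x) * q x))) ^ 2 ≤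
      ‖G‖ ^ 2 * (L * L + (2 * L * P + 2)) * Q := by
    obtain ⟨he, he'⟩ := hv.neg_sin_mul hc.prim hc.memLp hB
    have h1 := he.isNeumann_neumannField.norm_sq_le he.prim he.memLp_fun he.memLp one_pos
    have h2 : ∫ x, (-(Real.sin (φ x) * ψ x)) ^ 2 ≤ ∫ x, ψ x ^ 2 :=
      integral_mono he.memLp_fun.integrable_sq hv.memLp_fun.integrable_sq fun x => by
        simp only [neg_sq, mul_pow]
        exact mul_le_of_le_one_left (sq_nonneg _) (Real.sin_sq_le_one _)
    rw [hB2] at he'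
    set N := neumannField fun x => -(Real.cos (φ x) * p x * ψ x + Real.sin (φ x) * q x)
    have h3 : (inner ℝ G N) ^ 2 ≤ ‖G‖ ^ 2 * ‖N‖ ^ 2 := by
      rw [← mul_pow]
      exact sq_le_sq.2 ((abs_real_inner_le_norm G N).trans (le_abs_self _))
    calc _ ≤ ‖G‖ ^ 2 * ‖N‖ ^ 2 := h3
      _ ≤ ‖G‖ ^ 2 * ((L * L + (2 * L * P + 2)) * Q) := by
          gcongr
          linarith
      _ = _ := by ring
  rw [firstVariation]
  set a := ∫ x, p x * q x
  set b := ∫ x, Real.sin (φ x) * (h - Real.cos (φ x)) * ψ x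
  set c : ℝ := inner ℝ G (neumannField fun x =>
      -(Real.cos (φ x) * p x * ψ x + Real.sin (φ x) * q x))
  calc (a + b + c) ^ 2 ≤ 3 * (a ^ 2 + b ^ 2 + c ^ 2) := by
        nlinarith [sq_nonneg (a - b), sq_nonneg (b - c), sq_nonneg (a - c)]
    _ ≤ 3 * (P * Q + (1 + |h|) ^ 2 * L * (L * L) * Q +
        ‖G‖ ^ 2 * (L * L + (2 * L * P + 2)) * Q) := by gcongr
    _ = _ := by ring

/-- By `expansion`, the energy along `φ + t ζ` is `E₀ + t * firstVariation + O(t²)`. -/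
theorem firstVariation_eq_zero_of_isTest (hc : IsConfig h φ p G) {m : ℝ → Circle}
    (hm : ∀ᵐ x, m x = Circle.exp (φ x)) (hcrit : IsCritical h m) {ζ : ℝ → ℝ} (hζ : IsTest ζ) :
    firstVariation h φ p G ζ (deriv ζ) = 0 := by
  have hv := IsVariation.of_isTest hζ
  obtain ⟨M, hM0, hM⟩ := hv.exists_bound
  set ℓ := firstVariation h φ p G ζ (deriv ζ) with hℓ
  set E : ℝ → ℝ := fun t => (energy h (fun x => Circle.exp (t * ζ x) * m x)).toReal with hE
  set P := ∫ x, p x ^ 2 with hP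
  set Q := ∫ x, deriv ζ x ^ 2 with hQ
  set Z := ∫ x, ζ x ^ 2 with hZ
  have hP0 : 0 ≤ P := integral_nonneg fun x => sq_nonneg _
  have hQ0 : 0 ≤ Q := integral_nonneg fun x => sq_nonneg _
  have hZ0 : 0 ≤ Z := integral_nonneg fun x => sq_nonneg _
  set E₀ := (1 / 2) * (∫ x, p x ^ 2) + (∫ x, anisotropy h (Circle.exp (φ x))) +
    (1 / 2) * ‖G‖ ^ 2 with hE₀
  set L := ‖G‖ ^ 2 * (M ^ 2 * Z + (2 * M ^ 4 * P + 2 * M ^ 2 * Q)) with hL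
  have hL0 : 0 ≤ L := by positivity
  have hexp : ∀ t, |E t - E₀ - t * ℓ| ≤
      ((1 / 2) * Q + (2 + |h|) * Z + (Z + M ^ 2 * P + Q) + √L) * t ^ 2 := by
    intro t
    obtain ⟨G', R, D, S, hc', heq, hR, hD0, hD, hS⟩ := hc.expansion (hv.const_mul t)
      (B := |t| * M) (fun x => by rw [abs_mul]; gcongr; exact hM x)
    have hmt : ∀ᵐ x, Circle.exp (t * ζ x) * m x = Circle.exp (φ x + t * ζ x) := by
      filter_upwards [hm] with x hx
      rw [hx, Circle.exp_add, mul_comm]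
    have hEt : E t = _ := hc'.energy_toReal hmt
    rw [hEt, heq, hc.firstVariation_const_mul hv]
    simp only [mul_pow, integral_const_mul, sq_abs] at hR hD hS ⊢
    have hS1 := hS 1 one_pos
    have e4 : |t| ^ 4 = (t ^ 2) ^ 2 := by
      rw [← abs_pow, abs_of_nonneg (by positivity)]; ring
    have hS2 : |S| ≤ √L * t ^ 2 := by
      apply abs_le_of_sq_le_sq _ (by positivity)
      refine hS1.trans (le_of_eq ?_)
      rw [mul_pow, Real.sq_sqrt hL0, hL, e4]
      ring
    have e : E₀ + t * ℓ + 1 / 2 * (t ^ 2 * Q) + R + D + S - E₀ - t * ℓ =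
        1 / 2 * (t ^ 2 * Q) + R + D + S := by ring
    rw [e]
    have hR' := abs_le.1 hR
    have hS' := abs_le.1 hS2
    have hpos : 0 ≤ t ^ 2 * Q := by positivity
    have hpos2 : 0 ≤ t ^ 2 * Z := by positivity
    have hpos3 : 0 ≤ t ^ 2 * M ^ 2 * P := by positivity
    rw [abs_le]
    constructor <;> nlinarith
  have h0 : HasDerivAt (fun t => E t - E₀ - t * ℓ) 0 0 := by
    have hO : (fun t => E t - E₀ - t * ℓ) =O[𝓝 0] fun t => ‖t - 0‖ ^ 2 := by
      refine Asymptotics.IsBigO.of_bound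
        ((1 / 2) * Q + (2 + |h|) * Z + (Z + M ^ 2 * P + Q) + √L) (.of_forall fun t => ?_)
      simpa using hexp t
    simpa using (hO.hasFDerivAt one_lt_two).hasDerivAt
  have h1 : HasDerivAt (fun t => E t - E₀ - t * ℓ) (0 - 1 * ℓ) 0 :=
    ((hcrit ζ hζ).sub_const E₀).sub ((hasDerivAt_id 0).mul_const ℓ)
  have := h0.unique h1
  linarith

/-- Criticality tests against smooth variations only; by density it extends to all variations. -/
theorem firstVariation_eq_zero (hc : IsConfig h φ p G) {m : ℝ → Circle}
    (hm : ∀ᵐ x, m x = Circle.exp (φ x)) (hcrit : IsCritical h m) (hv : IsVariation ψ q) :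
    firstVariation h φ p G ψ q = 0 := by
  obtain ⟨A, hA, hψ⟩ := exists_abs_bound_of_hasCompactSupport hv.supp
  obtain ⟨C, hC⟩ := hc.exists_firstVariation_bound (A := A + 1) (by linarith)
  obtain ⟨K, hK, happ⟩ := hv.exists_isTest_approx hA hψ
  have key : ∀ ε, 0 < ε → firstVariation h φ p G ψ q ^ 2 ≤ |C| * (K * ε ^ 2) := by
    intro ε hε
    obtain ⟨ζ, hζ, hζ0, hle⟩ := happ ε hε
    have hvζ := IsVariation.of_isTest hζ
    have h1 := hc.firstVariation_sub hv hvζ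
    rw [hc.firstVariation_eq_zero_of_isTest hm hcrit hζ, sub_zero] at h1
    rw [← h1]
    refine (hC _ _ (hv.sub hvζ) fun x hx => ?_).trans ?_
    · rw [hψ x (by linarith), hζ0 x hx, sub_zero]
    · have h2 : 0 ≤ ∫ x, (q x - deriv ζ x) ^ 2 := integral_nonneg fun x => sq_nonneg _
      exact mul_le_mul (le_abs_self C) hle h2 (abs_nonneg C)
  have hlim : Tendsto (fun ε : ℝ => |C| * (K * ε ^ 2)) (𝓝[>] 0) (𝓝 0) := by
    have : Continuous fun ε : ℝ => |C| * (K * ε ^ 2) := by fun_prop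
    simpa using (this.tendsto 0).mono_left nhdsWithin_le_nhds
  have := ge_of_tendsto hlim (eventually_mem_nhdsWithin.mono fun ε hε => key ε hε)
  exact pow_eq_zero_iff two_ne_zero |>.1 (le_antisymm this (sq_nonneg _))

end IsConfig

/-! ### Inner variations of the line -/

/-- A smooth cutoff function, equal to `1` on `(-∞, 1]` and to `0` on `[2, ∞)`. -/
def cutoff (τ : ℝ) : ℝ := Real.smoothTransition (2 - τ)

theorem contDiff_cutoff : ContDiff ℝ ∞ cutoff :=
  Real.smoothTransition.contDiff.comp (contDiff_const.sub contDiff_id)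

theorem cutoff_of_le_one {τ : ℝ} (h : τ ≤ 1) : cutoff τ = 1 :=
  Real.smoothTransition.one_of_one_le (by linarith)

theorem cutoff_of_two_le {τ : ℝ} (h : 2 ≤ τ) : cutoff τ = 0 :=
  Real.smoothTransition.zero_of_nonpos (by linarith)

theorem cutoff_nonneg (τ : ℝ) : 0 ≤ cutoff τ := Real.smoothTransition.nonneg _

theorem cutoff_le_one (τ : ℝ) : cutoff τ ≤ 1 := Real.smoothTransition.le_one _

theorem hasDerivAt_cutoff (τ : ℝ) : HasDerivAt cutoff (deriv cutoff τ) τ :=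
  ((contDiff_cutoff.differentiable (by simp)) τ).hasDerivAt

theorem deriv_cutoff_of_lt_one {τ : ℝ} (h : τ < 1) : deriv cutoff τ = 0 := by
  have : cutoff =ᶠ[𝓝 τ] fun _ => 1 := by
    filter_upwards [Iio_mem_nhds h] with t ht
    exact cutoff_of_le_one (le_of_lt ht)
  rw [this.deriv_eq, deriv_const]

theorem deriv_cutoff_of_two_lt {τ : ℝ} (h : 2 < τ) : deriv cutoff τ = 0 := by
  have : cutoff =ᶠ[𝓝 τ] fun _ => 0 := by
    filter_upwards [Ioi_mem_nhds h] with t ht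
    exact cutoff_of_two_le (le_of_lt ht)
  rw [this.deriv_eq, deriv_const]

/-- The quantity `2 τ χ'(τ)`, for the cutoff `χ`, measures both the slope of the cut-off dilation
and its failure to be conformal, at `τ = κ |z|²`; it is bounded uniformly in the scale `κ`. -/
theorem exists_cutoff_bound : ∃ M, 0 ≤ M ∧ ∀ τ, |2 * τ * deriv cutoff τ| ≤ M := by
  have hc : Continuous fun τ => 2 * τ * deriv cutoff τ := by
    have := contDiff_cutoff.continuous_deriv (by simp)
    fun_prop
  obtain ⟨M, hM⟩ := isCompact_Icc (a := (1 : ℝ)) (b := 2) |>.exists_bound_of_continuousOn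
    hc.continuousOn
  have hM0 : 0 ≤ M := (norm_nonneg _).trans (hM 1 ⟨le_rfl, one_le_two⟩)
  refine ⟨M, hM0, fun τ => ?_⟩
  by_cases h : τ ∈ Icc (1 : ℝ) 2
  · exact hM τ h
  · rw [mem_Icc, not_and_or, not_le, not_le] at h
    rcases h with h | h
    · simpa [deriv_cutoff_of_lt_one h] using hM0
    · simpa [deriv_cutoff_of_two_lt h] using hM0

/-- The generator of the inner variation on the boundary: the dilation field `x`, cut off at
distance of order `κ ^ (-1/2)`. -/
def dilation (κ x : ℝ) : ℝ := cutoff (κ * x ^ 2) * x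

/-- The derivative of `dilation κ`. -/
def dilationDeriv (κ x : ℝ) : ℝ :=
  cutoff (κ * x ^ 2) + 2 * (κ * x ^ 2) * deriv cutoff (κ * x ^ 2)

theorem hasDerivAt_dilation (κ x : ℝ) : HasDerivAt (dilation κ) (dilationDeriv κ x) x := by
  have h1 : HasDerivAt (fun x : ℝ => κ * x ^ 2) (κ * (2 * x)) x := by
    simpa using (hasDerivAt_pow 2 x).const_mul κ
  have := ((hasDerivAt_cutoff _).comp x h1).mul (hasDerivAt_id x)
  refine this.congr_deriv ?_
  simp [dilationDeriv]
  ring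

theorem continuous_dilationDeriv (κ : ℝ) : Continuous (dilationDeriv κ) := by
  have h1 := contDiff_cutoff.continuous
  have h2 := contDiff_cutoff.continuous_deriv (by simp)
  unfold dilationDeriv
  fun_prop

theorem dilation_eq_zero {κ x : ℝ} (h : 2 ≤ κ * x ^ 2) : dilation κ x = 0 := by
  simp [dilation, cutoff_of_two_le h]

theorem dilationDeriv_eq_one {κ x : ℝ} (h : κ * x ^ 2 < 1) : dilationDeriv κ x = 1 := by
  simp [dilationDeriv, cutoff_of_le_one h.le, deriv_cutoff_of_lt_one h]

theorem abs_dilationDeriv_le {M : ℝ} (hM : ∀ τ, |2 * τ * deriv cutoff τ| ≤ M) (κ x : ℝ) :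
    |dilationDeriv κ x| ≤ 1 + M := by
  refine (abs_add_le _ _).trans (add_le_add ?_ (hM _))
  rw [abs_of_nonneg (cutoff_nonneg _)]
  exact cutoff_le_one _

theorem abs_dilation_le {κ A : ℝ} (hκ : 0 < κ) (hA : 0 ≤ A) (h : 2 ≤ κ * A ^ 2) (x : ℝ) :
    |dilation κ x| ≤ A := by
  by_cases hx : |x| ≤ A
  · rw [dilation, abs_mul, abs_of_nonneg (cutoff_nonneg _)]
    exact (mul_le_of_le_one_left (abs_nonneg _) (cutoff_le_one _)).trans hx
  · rw [dilation_eq_zero, abs_zero]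
    · exact hA
    · refine h.trans ?_
      rw [← sq_abs x]
      have := (not_le.1 hx).le
      gcongr

theorem dilation_eq_zero_of_lt_abs {κ A x : ℝ} (hκ : 0 < κ) (hA : 0 ≤ A) (h : 2 ≤ κ * A ^ 2)
    (hx : A < |x|) : dilation κ x = 0 := by
  apply dilation_eq_zero
  refine h.trans ?_
  rw [← sq_abs x]
  gcongr

/-- `Ψ` is a `C¹` diffeomorphism of the line equal to the identity outside `[-A, A]`, with
derivative `D ≥ 1/2` and inverse `θ`. -/
structure IsDiffeo (Ψ D θ : ℝ → ℝ) (A : ℝ) : Prop where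
  hasDerivAt : ∀ x, HasDerivAt Ψ (D x) x
  half_le : ∀ x, 1 / 2 ≤ D x
  continuous : Continuous D
  eq_self : ∀ x, A < |x| → Ψ x = x
  left_inv : ∀ x, θ (Ψ x) = x
  right_inv : ∀ x, Ψ (θ x) = x

theorem exists_isDiffeo {Ψ D : ℝ → ℝ} {A : ℝ} (hd : ∀ x, HasDerivAt Ψ (D x) x)
    (hD : ∀ x, 1 / 2 ≤ D x) (hc : Continuous D) (hA : ∀ x, A < |x| → Ψ x = x) :
    ∃ θ, IsDiffeo Ψ D θ A := by
  have hmono : StrictMono Ψ := strictMono_of_deriv_pos fun x => by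
    rw [(hd x).deriv]; linarith [hD x]
  have hcΨ : Continuous Ψ := continuous_iff_continuousAt.2 fun x => (hd x).continuousAt
  have htop : Tendsto Ψ atTop atTop := by
    refine tendsto_id.congr' ?_
    filter_upwards [eventually_gt_atTop A] with x hx
    exact (hA x (hx.trans_le (le_abs_self x))).symm
  have hbot : Tendsto Ψ atBot atBot := by
    refine tendsto_id.congr' ?_
    filter_upwards [eventually_lt_atBot (-A)] with x hx
    exact (hA x ((lt_neg.2 hx).trans_le (neg_le_abs x))).symm
  have hsurj := hcΨ.surjective htop hbot
  choose θ hθ using hsurj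
  exact ⟨θ, hd, hD, hc, hA, fun x => hmono.injective (hθ _), hθ⟩

namespace IsDiffeo

variable {Ψ D θ : ℝ → ℝ} {A : ℝ}

theorem pos (h : IsDiffeo Ψ D θ A) (x : ℝ) : 0 < D x := by linarith [h.half_le x]

theorem strictMono (h : IsDiffeo Ψ D θ A) : StrictMono Ψ := strictMono_of_deriv_pos fun x => by
  rw [(h.hasDerivAt x).deriv]; exact h.pos x

theorem surjective (h : IsDiffeo Ψ D θ A) : Function.Surjective Ψ := fun x => ⟨θ x, h.right_inv x⟩

theorem continuous_inv (h : IsDiffeo Ψ D θ A) : Continuous θ := by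
  have e : θ = (h.strictMono.orderIsoOfSurjective Ψ h.surjective).symm := by
    ext x
    apply h.strictMono.injective
    rw [h.right_inv]
    exact ((h.strictMono.orderIsoOfSurjective Ψ h.surjective).apply_symm_apply x).symm
  rw [e]
  exact OrderIso.continuous _

theorem hasDerivAt_inv (h : IsDiffeo Ψ D θ A) (x : ℝ) : HasDerivAt θ (D (θ x))⁻¹ x :=
  HasDerivAt.of_local_left_inverse h.continuous_inv.continuousAt (h.hasDerivAt _)
    (h.pos _).ne' (.of_forall h.right_inv)

theorem inv_eq_self (h : IsDiffeo Ψ D θ A) {x : ℝ} (hx : A < |x|) : θ x = x := by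
  apply h.strictMono.injective
  rw [h.right_inv, h.eq_self x hx]

theorem integral_eq (h : IsDiffeo Ψ D θ A) (g : ℝ → ℝ) : ∫ x, g x = ∫ x, D x * g (Ψ x) := by
  have := integral_image_eq_integral_abs_deriv_smul MeasurableSet.univ
    (fun x _ => (h.hasDerivAt x).hasDerivWithinAt) h.strictMono.injective.injOn g
  simpa [image_univ, h.surjective.range_eq, abs_of_pos (h.pos _)] using this

theorem integrable_iff (h : IsDiffeo Ψ D θ A) (g : ℝ → ℝ) :
    Integrable g ↔ Integrable fun x => D x * g (Ψ x) := by
  have := integrableOn_image_iff_integrableOn_abs_deriv_smul MeasurableSet.univ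
    (fun x _ => (h.hasDerivAt x).hasDerivWithinAt) h.strictMono.injective.injOn g
  simpa [image_univ, h.surjective.range_eq, abs_of_pos (h.pos _)] using this

theorem isPrimitive_comp (h : IsDiffeo Ψ D θ A) {φ p : ℝ → ℝ} (hφ : IsPrimitive φ p) :
    IsPrimitive (fun x => φ (θ x)) (fun x => (D (θ x))⁻¹ * p (θ x)) := by
  have hnn : ∀ x, 0 ≤ (D (θ x))⁻¹ := fun x => (inv_pos.2 (h.pos _)).le
  have hmono : Monotone θ := fun a b hab => by
    by_contra hlt
    have := h.strictMono (not_le.1 hlt)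
    rw [h.right_inv, h.right_inv] at this
    linarith
  have hIcc : ∀ a b, a ≤ b → IntegrableOn (fun x => (D (θ x))⁻¹ * p (θ x)) (Icc a b) := by
    intro a b hab
    exact (integrableOn_Icc_deriv_smul_iff_of_deriv_nonneg h.continuous_inv.continuousOn
      (fun x _ => h.hasDerivAt_inv x) (fun x _ => hnn x) hab).2
      (hφ.1.integrableOn_isCompact isCompact_Icc)
  have hle : ∀ a b, a ≤ b → ∫ x in a..b, (D (θ x))⁻¹ * p (θ x) = φ (θ b) - φ (θ a) := by
    intro a b hab
    have := integral_Icc_deriv_smul_of_deriv_nonneg (g := p) h.continuous_inv.continuousOn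
      (fun x _ => h.hasDerivAt_inv x) (fun x _ => hnn x) hab
    rw [intervalIntegral.integral_of_le hab, ← integral_Icc_eq_integral_Ioc]
    simp only [smul_eq_mul] at this
    rw [this, integral_Icc_eq_integral_Ioc, ← intervalIntegral.integral_of_le (hmono hab), hφ.2]
  refine ⟨?_, fun a b => ?_⟩
  · rw [locallyIntegrable_iff]
    intro K hK
    obtain ⟨r, hr⟩ := hK.isBounded.subset_closedBall 0
    rcases le_total 0 r with h0 | h0
    · refine (hIcc (-r) r (by linarith)).mono_set (hr.trans ?_)
      rw [Real.closedBall_eq_Icc, zero_sub, zero_add]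
    · refine (hIcc 0 0 le_rfl).mono_set (hr.trans ?_)
      rw [Real.closedBall_eq_Icc]
      exact Icc_subset_Icc (by linarith) (by linarith)
  · rcases le_total a b with hab | hab
    · exact hle a b hab
    · rw [intervalIntegral.integral_symm, hle b a hab]
      ring

theorem isVariation (h : IsDiffeo Ψ D θ A) {φ p : ℝ → ℝ} (hφ : IsPrimitive φ p)
    (hp : MemLp p 2) :
    IsVariation (fun x => φ (θ x) - φ x) (fun x => (D (θ x))⁻¹ * p (θ x) - p x) := by
  have hprim := h.isPrimitive_comp hφ
  refine ⟨hprim.sub hφ, hasCompactSupport_of_abs_bound (A := A) fun x hx => ?_, ?_⟩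
  · rw [h.inv_eq_self hx, sub_self]
  · refine MemLp.sub ?_ hp
    rw [memLp_two_iff_integrable_sq hprim.1.aestronglyMeasurable, h.integrable_iff]
    have hi : Integrable fun x => 2 * p x ^ 2 := hp.integrable_sq.const_mul 2
    have e : ∀ x, D x * ((D (θ (Ψ x)))⁻¹ * p (θ (Ψ x))) ^ 2 = (D x)⁻¹ * p x ^ 2 := by
      intro x
      rw [h.left_inv]
      have := (h.pos x).ne'
      field_simp
    simp only [e]
    refine hi.mono' ?_ (.of_forall fun x => ?_)
    · exact (h.continuous.inv₀ fun x => (h.pos x).ne').aestronglyMeasurable.mul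
        (hp.aestronglyMeasurable.pow 2)
    · rw [Real.norm_of_nonneg (mul_nonneg (inv_pos.2 (h.pos x)).le (sq_nonneg _))]
      gcongr
      rw [inv_le_comm₀ (h.pos x) two_pos]
      have := h.half_le x
      linarith

/-- Moving the argument by at most `c` changes a function with derivative `p ∈ L²` by `O(√c)`
pointwise and by `O(c)` in `L²`. -/
theorem variation_bounds (h : IsDiffeo Ψ D θ A) {φ p : ℝ → ℝ} (hφ : IsPrimitive φ p)
    (hp : MemLp p 2) {c : ℝ} (hc : 0 ≤ c) (hΨ : ∀ x, |Ψ x - x| ≤ c) :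
    (∀ x, (φ (θ x) - φ x) ^ 2 ≤ c * ∫ x, p x ^ 2) ∧
      ∫ x, (φ (θ x) - φ x) ^ 2 ≤ 2 * c ^ 2 * ∫ x, p x ^ 2 := by
  have hθ : ∀ x, |θ x - x| ≤ c := fun x => by
    have := hΨ (θ x)
    rwa [h.right_inv, abs_sub_comm] at this
  have h1 : ∀ x, (φ (θ x) - φ x) ^ 2 ≤ c * ∫ t in Icc (x - c) (x + c), p t ^ 2 := by
    intro x
    have hx := abs_le.1 (hθ x)
    rcases le_total x (θ x) with hle | hle
    · rw [← hφ.2]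
      refine (sq_intervalIntegral_le hp hle).trans ?_
      have h2 : ∫ t in Icc x (θ x), p t ^ 2 ≤ ∫ t in Icc (x - c) (x + c), p t ^ 2 :=
        setIntegral_mono_set hp.integrable_sq.integrableOn (.of_forall fun t => sq_nonneg _)
          (Icc_subset_Icc (by linarith) (by linarith)).eventuallyLE
      exact mul_le_mul (by linarith) h2 (integral_nonneg fun t => sq_nonneg _) hc
    · rw [← neg_sq, neg_sub, ← hφ.2]
      refine (sq_intervalIntegral_le hp hle).trans ?_
      have h2 : ∫ t in Icc (θ x) x, p t ^ 2 ≤ ∫ t in Icc (x - c) (x + c), p t ^ 2 :=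
        setIntegral_mono_set hp.integrable_sq.integrableOn (.of_forall fun t => sq_nonneg _)
          (Icc_subset_Icc (by linarith) (by linarith)).eventuallyLE
      exact mul_le_mul (by linarith) h2 (integral_nonneg fun t => sq_nonneg _) hc
  refine ⟨fun x => (h1 x).trans (mul_le_mul_of_nonneg_left ?_ hc), ?_⟩
  · exact setIntegral_le_integral hp.integrable_sq (.of_forall fun t => sq_nonneg _)
  · -- integrate the local bound, which is a convolution with the indicator of `[-c, c]`
    set f : ℝ → ℝ := (Icc (-c) c).indicator fun _ => 1 with hf
    set g : ℝ → ℝ := fun t => p t ^ 2 with hg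
    have hfi : Integrable f := (integrable_indicator_iff measurableSet_Icc).2 (integrable_const _)
    have hgi : Integrable g := hp.integrable_sq
    have hconv : ∀ x, (f ⋆[ContinuousLinearMap.mul ℝ ℝ] g) x =
        ∫ t in Icc (x - c) (x + c), p t ^ 2 := by
      intro x
      rw [convolution_eq_swap, ← integral_indicator measurableSet_Icc]
      congr 1
      ext t
      simp only [hf, hg, ContinuousLinearMap.mul_apply']
      by_cases ht : t ∈ Icc (x - c) (x + c)
      · rw [indicator_of_mem ht, indicator_of_mem, one_mul]
        exact ⟨by linarith [ht.2], by linarith [ht.1]⟩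
      · rw [indicator_of_notMem ht, indicator_of_notMem, zero_mul]
        intro h
        exact ht ⟨by linarith [h.2], by linarith [h.1]⟩
    have hint := integral_convolution (ContinuousLinearMap.mul ℝ ℝ) hfi hgi (μ := volume)
    have hci : Integrable (f ⋆[ContinuousLinearMap.mul ℝ ℝ] g) :=
      hfi.integrable_convolution (ContinuousLinearMap.mul ℝ ℝ) hgi
    have hf1 : ∫ x, f x = 2 * c := by
      rw [hf, integral_indicator measurableSet_Icc, setIntegral_const, Measure.real,
        Real.volume_Icc, ENNReal.toReal_ofReal (by linarith), smul_eq_mul]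
      ring
    calc ∫ x, (φ (θ x) - φ x) ^ 2 ≤ ∫ x, c * (f ⋆[ContinuousLinearMap.mul ℝ ℝ] g) x := by
          refine integral_mono (h.isVariation hφ hp).memLp_fun.integrable_sq
            (hci.const_mul c) fun x => ?_
          simp only
          rw [hconv]
          exact h1 x
      _ = 2 * c ^ 2 * ∫ x, p x ^ 2 := by
          rw [integral_const_mul, hint, hf1]
          simp only [hg, ContinuousLinearMap.mul_apply']
          ring

end IsDiffeo

/-! ### Nearly conformal deformations of the half-plane -/

/-- The cut-off dilation field on the plane, extending `dilation κ`. -/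
def planeDilation (κ : ℝ) (z : ℝ × ℝ) : ℝ × ℝ := cutoff (κ * (z.1 ^ 2 + z.2 ^ 2)) • z

theorem contDiff_planeDilation (κ : ℝ) : ContDiff ℝ ∞ (planeDilation κ) := by
  have : ContDiff ℝ ∞ fun z : ℝ × ℝ => κ * (z.1 ^ 2 + z.2 ^ 2) := by fun_prop
  exact (contDiff_cutoff.comp this).smul contDiff_id

theorem exists_planeDilation_eq_zero {κ : ℝ} (hκ : 0 < κ) :
    ∃ r : ℝ, ∀ z : ℝ × ℝ, z ∉ Metric.closedBall (0 : ℝ × ℝ) r → planeDilation κ z = 0 := by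
  refine ⟨√(2 / κ), fun z hz => ?_⟩
  rw [mem_closedBall_zero_iff, not_le, Prod.norm_def, lt_max_iff, Real.norm_eq_abs,
    Real.norm_eq_abs] at hz
  have h0 : 0 ≤ 2 / κ := by positivity
  have h2 : 2 ≤ κ * (z.1 ^ 2 + z.2 ^ 2) := by
    have key : 2 / κ ≤ z.1 ^ 2 + z.2 ^ 2 := by
      rcases hz with h | h
      · have := pow_le_pow_left₀ (Real.sqrt_nonneg _) h.le 2
        rw [Real.sq_sqrt h0, sq_abs] at this
        nlinarith [sq_nonneg z.2]
      · have := pow_le_pow_left₀ (Real.sqrt_nonneg _) h.le 2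
        rw [Real.sq_sqrt h0, sq_abs] at this
        nlinarith [sq_nonneg z.1]
    rwa [div_le_iff₀' hκ] at key
  rw [planeDilation, cutoff_of_two_le h2, zero_smul]

theorem hasCompactSupport_planeDilation {κ : ℝ} (hκ : 0 < κ) :
    HasCompactSupport (planeDilation κ) := by
  obtain ⟨r, hr⟩ := exists_planeDilation_eq_zero hκ
  exact HasCompactSupport.intro (isCompact_closedBall _ _) hr

/-- The deformation `z ↦ z + s X(z)` of the plane along the cut-off dilation field `X`. -/
def deform (κ s : ℝ) (z : ℝ × ℝ) : ℝ × ℝ := z + s • planeDilation κ z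

/-- A perturbation of the identity with Lipschitz constant below one is injective. -/
theorem exists_deform_injective {κ : ℝ} (hκ : 0 < κ) :
    ∃ s₀, 0 < s₀ ∧ ∀ s, |s| ≤ s₀ → Function.Injective (deform κ s) := by
  obtain ⟨C, hC⟩ := ContDiff.lipschitzWith_of_hasCompactSupport (𝕂 := ℝ)
    (hasCompactSupport_planeDilation hκ) (contDiff_planeDilation κ) (by simp)
  refine ⟨1 / (2 * (C + 1)), by positivity, fun s hs z w hzw => ?_⟩
  have h1 := hC.dist_le_mul z w
  have h2 : z - w = s • (planeDilation κ w - planeDilation κ z) := by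
    have : z + s • planeDilation κ z = w + s • planeDilation κ w := hzw
    rw [smul_sub]
    linear_combination this
  have h3 : ‖z - w‖ ≤ |s| * (C * ‖z - w‖) := by
    calc ‖z - w‖ = |s| * ‖planeDilation κ w - planeDilation κ z‖ := by
          rw [h2, norm_smul, Real.norm_eq_abs]
      _ ≤ _ := by
          gcongr
          rwa [dist_eq_norm, dist_eq_norm, ← norm_neg, neg_sub] at h1
  have h4 : |s| * C ≤ 1 / 2 := by
    calc |s| * C ≤ 1 / (2 * (C + 1)) * (C + 1) := by gcongr; simp
      _ = 1 / 2 := by field_simp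
  have h5 : ‖z - w‖ ≤ 0 := by nlinarith [norm_nonneg (z - w)]
  exact sub_eq_zero.1 (norm_le_zero_iff.1 h5)

theorem contDiff_deform (κ s : ℝ) : ContDiff ℝ ∞ (deform κ s) :=
  contDiff_id.add ((contDiff_planeDilation κ).const_smul s)

theorem IsTest.comp_deform {ζ : ℝ × ℝ → ℝ} (hζ : IsTest ζ) {κ : ℝ} (hκ : 0 < κ) (s : ℝ) :
    IsTest fun z => ζ (deform κ s z) := by
  refine ⟨hζ.1.comp (contDiff_deform κ s), ?_⟩
  obtain ⟨r, hr⟩ := exists_planeDilation_eq_zero hκ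
  refine HasCompactSupport.intro (hζ.2.isCompact.union (isCompact_closedBall (0 : ℝ × ℝ) r))
    fun z hz => ?_
  rw [mem_union, not_or] at hz
  rw [deform, hr z hz.2, smul_zero, add_zero]
  exact image_eq_zero_of_notMem_tsupport hz.1

theorem deform_trace (κ s x : ℝ) : deform κ s (x, 0) = (x + s * dilation κ x, 0) := by
  ext
  · simp [deform, planeDilation, dilation]
  · simp [deform, planeDilation]

section Distortion

variable (κ s : ℝ) (z : ℝ × ℝ)

/-- The tangential singular value of the derivative of `deform κ s`. -/
def tangentialStretch : ℝ := 1 + s * cutoff (κ * (z.1 ^ 2 + z.2 ^ 2))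

/-- The difference of the radial and the tangential singular value of the derivative of
`deform κ s`, divided by `|z|²`. -/
def radialExcess : ℝ := s * (2 * κ * deriv cutoff (κ * (z.1 ^ 2 + z.2 ^ 2)))

theorem hasFDerivAt_deform : HasFDerivAt (deform κ s) (fderiv ℝ (deform κ s) z) z :=
  ((contDiff_deform κ s).differentiable (by simp) z).hasFDerivAt

/-- The derivative is a multiple of the identity plus a multiple of `z ⊗ z`. -/
theorem fderiv_deform_apply (v : ℝ × ℝ) : fderiv ℝ (deform κ s) z v =
    tangentialStretch κ s z • v + (radialExcess κ s z * (z.1 * v.1 + z.2 * v.2)) • z := by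
  have h0 : HasFDerivAt (fun z : ℝ × ℝ => κ * (z.1 ^ 2 + z.2 ^ 2))
      (κ • ((2 * z.1) • ContinuousLinearMap.fst ℝ ℝ ℝ +
        (2 * z.2) • ContinuousLinearMap.snd ℝ ℝ ℝ)) z := by
    have h1 := (hasFDerivAt_fst (𝕜 := ℝ) (p := z)).pow 2
    have h2 := (hasFDerivAt_snd (𝕜 := ℝ) (p := z)).pow 2
    simpa using (h1.add h2).const_mul κ
  have h1 := (hasDerivAt_cutoff (κ * (z.1 ^ 2 + z.2 ^ 2))).comp_hasFDerivAt z h0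
  have h2 := (hasFDerivAt_id (𝕜 := ℝ) z).add
    ((h1.smul (hasFDerivAt_id (𝕜 := ℝ) z)).const_smul s)
  have h3 : fderiv ℝ (deform κ s) z = _ := HasFDerivAt.fderiv h2
  rw [h3]
  ext
  · simp [tangentialStretch, radialExcess]; ring
  · simp [tangentialStretch, radialExcess]; ring

theorem det_fderiv_deform : (fderiv ℝ (deform κ s) z).det = tangentialStretch κ s z *
    (tangentialStretch κ s z + radialExcess κ s z * (z.1 ^ 2 + z.2 ^ 2)) := by
  rw [ContinuousLinearMap.det, ← LinearMap.det_toMatrix (Module.Basis.finTwoProd ℝ),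
    Matrix.det_fin_two]
  simp only [LinearMap.toMatrix_apply, Module.Basis.finTwoProd_zero,
    Module.Basis.finTwoProd_one, ContinuousLinearMap.coe_coe, fderiv_deform_apply]
  simp
  ring

variable {κ s z}

theorem norm_grad_comp_deform_sq {ζ : ℝ × ℝ → ℝ} (hζ : IsTest ζ) :
    ‖grad (fun z => ζ (deform κ s z)) z‖ ^ 2 =
      tangentialStretch κ s z ^ 2 * ‖grad ζ (deform κ s z)‖ ^ 2 +
      radialExcess κ s z * (2 * tangentialStretch κ s z +
        radialExcess κ s z * (z.1 ^ 2 + z.2 ^ 2)) *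
        (z.1 * grad ζ (deform κ s z) 0 + z.2 * grad ζ (deform κ s z) 1) ^ 2 := by
  have h1 : fderiv ℝ (fun z => ζ (deform κ s z)) z =
      (fderiv ℝ ζ (deform κ s z)).comp (fderiv ℝ (deform κ s) z) :=
    ((hζ.hasFDerivAt _).comp z (hasFDerivAt_deform κ s z)).fderiv
  have h2 : ∀ v : ℝ × ℝ, fderiv ℝ ζ (deform κ s z) v =
      v.1 * fderiv ℝ ζ (deform κ s z) (1, 0) + v.2 * fderiv ℝ ζ (deform κ s z) (0, 1) := by
    intro v
    have : v = v.1 • ((1, 0) : ℝ × ℝ) + v.2 • ((0, 1) : ℝ × ℝ) := by ext <;> simp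
    conv_lhs => rw [this, map_add, map_smul, map_smul]
    simp
  rw [norm_sq_fin_two, norm_sq_fin_two]
  simp only [grad, h1, ContinuousLinearMap.comp_apply, fderiv_deform_apply]
  simp only [h2 (_ + _)]
  simp
  ring

/-- The deformation is conformal for `κ |z|² < 1`, and its distortion is `1 + O(s)` elsewhere. -/
theorem norm_grad_comp_deform_sq_le {M : ℝ} (hM : ∀ τ, |2 * τ * deriv cutoff τ| ≤ M)
    (hs : |s| * (1 + M) ≤ 1 / 2) {ζ : ℝ × ℝ → ℝ} (hζ : IsTest ζ) :
    ‖grad (fun z => ζ (deform κ s z)) z‖ ^ 2 ≤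
      (1 + 2 * M * |s| * {z : ℝ × ℝ | 1 ≤ κ * (z.1 ^ 2 + z.2 ^ 2)}.indicator (fun _ => 1) z) *
        ((fderiv ℝ (deform κ s) z).det * ‖grad ζ (deform κ s z)‖ ^ 2) := by
  rw [norm_grad_comp_deform_sq hζ, det_fderiv_deform]
  set g := grad ζ (deform κ s z)
  have hcs : (z.1 * g 0 + z.2 * g 1) ^ 2 ≤ (z.1 ^ 2 + z.2 ^ 2) * ‖g‖ ^ 2 := by
    rw [norm_sq_fin_two]
    nlinarith [sq_nonneg (z.1 * g 1 - z.2 * g 0)]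
  have hN : 0 ≤ ‖g‖ ^ 2 := sq_nonneg _
  set N := ‖g‖ ^ 2
  set w := (z.1 * g 0 + z.2 * g 1) ^ 2
  have hw : 0 ≤ w := sq_nonneg _
  set τ := κ * (z.1 ^ 2 + z.2 ^ 2) with hτ
  have hM0 : 0 ≤ M := (abs_nonneg _).trans (hM 0)
  have hsM : |s| * M ≤ 1 / 2 := by nlinarith [abs_nonneg s]
  by_cases h : 1 ≤ τ
  · have hmem : z ∈ {z : ℝ × ℝ | 1 ≤ κ * (z.1 ^ 2 + z.2 ^ 2)} := h
    rw [indicator_of_mem hmem, mul_one]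
    have hρ0 : 0 ≤ z.1 ^ 2 + z.2 ^ 2 := by positivity
    set ρ := z.1 ^ 2 + z.2 ^ 2
    have hbρ : |radialExcess κ s z * ρ| ≤ M * |s| := by
      have e : radialExcess κ s z * ρ = s * (2 * τ * deriv cutoff τ) := by
        rw [radialExcess, hτ]; ring
      rw [e, abs_mul, mul_comm]
      gcongr
      exact hM τ
    have ha : 1 - |s| ≤ tangentialStretch κ s z := by
      have h1 : |s * cutoff τ| ≤ |s| := by
        rw [abs_mul, abs_of_nonneg (cutoff_nonneg _)]
        exact mul_le_of_le_one_right (abs_nonneg _) (cutoff_le_one _)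
      have := (abs_le.1 h1).1
      change 1 - |s| ≤ 1 + s * cutoff τ
      linarith
    set a := tangentialStretch κ s z
    set b := radialExcess κ s z
    have hbρ' := abs_le.1 hbρ
    have ha2 : 1 / 2 ≤ a := by nlinarith [abs_nonneg s]
    have hab2 : 1 / 2 ≤ a + b * ρ := by nlinarith [abs_nonneg s]
    have hms : 0 ≤ M * |s| := by positivity
    rcases le_total 0 b with hb | hb
    · have h1 : b * (2 * a + b * ρ) * w ≤ b * (2 * a + b * ρ) * (ρ * N) := by
        have : 0 ≤ b * (2 * a + b * ρ) := mul_nonneg hb (by linarith)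
        gcongr
      have h2 : (a + b * ρ) ≤ (1 + 2 * M * |s|) * a := by nlinarith
      have h3 : (a + b * ρ) ^ 2 ≤ (1 + 2 * M * |s|) * (a * (a + b * ρ)) := by nlinarith
      calc a ^ 2 * N + b * (2 * a + b * ρ) * w
          ≤ a ^ 2 * N + b * (2 * a + b * ρ) * (ρ * N) := by linarith
        _ = (a + b * ρ) ^ 2 * N := by ring
        _ ≤ (1 + 2 * M * |s|) * (a * (a + b * ρ)) * N := by gcongr
        _ = _ := by ring
    · have h1 : b * (2 * a + b * ρ) * w ≤ 0 :=
        mul_nonpos_of_nonpos_of_nonneg (mul_nonpos_of_nonpos_of_nonneg hb (by linarith)) hw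
      have h2 : a ≤ (1 + 2 * M * |s|) * (a + b * ρ) := by nlinarith
      have h3 : a ^ 2 ≤ (1 + 2 * M * |s|) * (a * (a + b * ρ)) := by nlinarith
      calc a ^ 2 * N + b * (2 * a + b * ρ) * w ≤ a ^ 2 * N := by linarith
        _ ≤ (1 + 2 * M * |s|) * (a * (a + b * ρ)) * N := by gcongr
        _ = _ := by ring
  · have hmem : z ∉ {z : ℝ × ℝ | 1 ≤ κ * (z.1 ^ 2 + z.2 ^ 2)} := h
    rw [indicator_of_notMem hmem]
    have hb : radialExcess κ s z = 0 := by
      rw [radialExcess, deriv_cutoff_of_lt_one (not_le.1 h)]; ring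
    rw [hb]
    apply le_of_eq
    ring

theorem det_fderiv_deform_nonneg {M : ℝ} (hM : ∀ τ, |2 * τ * deriv cutoff τ| ≤ M)
    (hs : |s| * (1 + M) ≤ 1 / 2) : 0 ≤ (fderiv ℝ (deform κ s) z).det := by
  rw [det_fderiv_deform]
  have hM0 : 0 ≤ M := (abs_nonneg _).trans (hM 0)
  set τ := κ * (z.1 ^ 2 + z.2 ^ 2) with hτ
  have h1 : |s * cutoff τ| ≤ |s| := by
    rw [abs_mul, abs_of_nonneg (cutoff_nonneg _)]
    exact mul_le_of_le_one_right (abs_nonneg _) (cutoff_le_one _)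
  have h2 : |s * (2 * τ * deriv cutoff τ)| ≤ |s| * M := by
    rw [abs_mul]
    gcongr
    exact hM τ
  have e1 : tangentialStretch κ s z = 1 + s * cutoff τ := rfl
  have e2 : radialExcess κ s z * (z.1 ^ 2 + z.2 ^ 2) = s * (2 * τ * deriv cutoff τ) := by
    rw [radialExcess, hτ]; ring
  have h1' := abs_le.1 h1
  have h2' := abs_le.1 h2
  rw [e2, e1]
  apply mul_nonneg <;> nlinarith [abs_nonneg s]

theorem deform_mem_halfPlane {M : ℝ} (hM : ∀ τ, |2 * τ * deriv cutoff τ| ≤ M)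
    (hs : |s| * (1 + M) ≤ 1 / 2) (hz : z ∈ halfPlane) : deform κ s z ∈ halfPlane := by
  have hM0 : 0 ≤ M := (abs_nonneg _).trans (hM 0)
  have h1 : |s * cutoff (κ * (z.1 ^ 2 + z.2 ^ 2))| ≤ |s| := by
    rw [abs_mul, abs_of_nonneg (cutoff_nonneg _)]
    exact mul_le_of_le_one_right (abs_nonneg _) (cutoff_le_one _)
  have h1' := abs_le.1 h1
  have hz' : 0 < z.2 := hz
  have e : (deform κ s z).2 = (1 + s * cutoff (κ * (z.1 ^ 2 + z.2 ^ 2))) * z.2 := by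
    simp [deform, planeDilation]; ring
  change 0 < (deform κ s z).2
  rw [e]
  apply mul_pos _ hz'
  nlinarith [abs_nonneg s]

end Distortion

/-! ### The stray field energy under deformations -/

theorem integrable_norm_sq (G : L2Field) :
    Integrable (fun z => ‖G z‖ ^ 2) (volume.restrict halfPlane) := by
  simpa [real_inner_self_eq_norm_sq] using L2.integrable_inner (𝕜 := ℝ) G G

theorem norm_sq_eq_integral (G : L2Field) : ‖G‖ ^ 2 = ∫ z in halfPlane, ‖G z‖ ^ 2 := by
  rw [← real_inner_self_eq_norm_sq, L2.inner_def]
  simp_rw [real_inner_self_eq_norm_sq]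

/-- The part of the stray field energy at distance at least `κ ^ (-1/2)` from the origin. -/
def tailEnergy (κ : ℝ) (G : L2Field) : ℝ :=
  ∫ z in halfPlane, {z : ℝ × ℝ | 1 ≤ κ * (z.1 ^ 2 + z.2 ^ 2)}.indicator (fun z => ‖G z‖ ^ 2) z

theorem measurableSet_tail (κ : ℝ) :
    MeasurableSet {z : ℝ × ℝ | 1 ≤ κ * (z.1 ^ 2 + z.2 ^ 2)} :=
  measurableSet_le measurable_const (by fun_prop)

/-- If the boundary functional of `v'` is that of `v` composed with the boundary deformation, then
the stray field energy of `v'` exceeds that of `v` at most by the distortion of `deform κ s`, which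
lives on the tail. Indeed testing `v'` with `ζ` amounts to testing `v` with `ζ ∘ deform κ s`, and
the Dirichlet integral is invariant under conformal maps. -/
theorem IsNeumann.norm_sq_le_of_deform {κ s M : ℝ} (hκ : 0 < κ)
    (hM : ∀ τ, |2 * τ * deriv cutoff τ| ≤ M) (hs : |s| * (1 + M) ≤ 1 / 2)
    (hinj : Function.Injective (deform κ s)) {v v' : ℝ → ℝ} {G G' : L2Field}
    (hG : IsNeumann v G) (hG' : IsNeumann v' G')
    (hvv : ∀ ζ : ℝ → ℝ, ∫ x, v' x * ζ x = ∫ x, v x * ζ (x + s * dilation κ x)) :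
    ‖G'‖ ^ 2 ≤ ‖G‖ ^ 2 + 2 * M * |s| * tailEnergy κ G := by
  have hM0 : 0 ≤ M := (abs_nonneg _).trans (hM 0)
  set B := {z : ℝ × ℝ | 1 ≤ κ * (z.1 ^ 2 + z.2 ^ 2)} with hB
  have hBm : MeasurableSet B := measurableSet_tail κ
  set k : ℝ × ℝ → ℝ := fun z => 1 + 2 * M * |s| * B.indicator (fun _ => 1) z with hk
  have hkm : Measurable k := by
    have : Measurable (B.indicator fun _ : ℝ × ℝ => (1 : ℝ)) := measurable_const.indicator hBm
    fun_prop
  have hk0 : ∀ z, 0 ≤ k z := fun z => by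
    have : 0 ≤ B.indicator (fun _ : ℝ × ℝ => (1 : ℝ)) z :=
      indicator_nonneg (fun _ _ => zero_le_one) z
    simp only [hk]
    positivity
  have hkG : ∀ z, k z * ‖G z‖ ^ 2 =
      ‖G z‖ ^ 2 + 2 * M * |s| * B.indicator (fun z => ‖G z‖ ^ 2) z := by
    intro z
    by_cases hz : z ∈ B
    · simp [hk, hz]; ring
    · simp [hk, hz]
  have hiB : Integrable (B.indicator fun z => ‖G z‖ ^ 2) (volume.restrict halfPlane) :=
    (integrable_norm_sq G).indicator hBm
  have hikG : Integrable (fun z => k z * ‖G z‖ ^ 2) (volume.restrict halfPlane) := by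
    simp_rw [hkG]
    exact (integrable_norm_sq G).add (hiB.const_mul _)
  have hI : ∫ z in halfPlane, k z * ‖G z‖ ^ 2 = ‖G‖ ^ 2 + 2 * M * |s| * tailEnergy κ G := by
    simp_rw [hkG]
    rw [integral_add (integrable_norm_sq G) (hiB.const_mul _), integral_const_mul,
      norm_sq_eq_integral, tailEnergy]
  rw [← hI]
  set I := ∫ z in halfPlane, k z * ‖G z‖ ^ 2 with hIdef
  have hI0 : 0 ≤ I := integral_nonneg fun z => mul_nonneg (hk0 z) (sq_nonneg _)
  have key : ‖G'‖ ≤ √I := by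
    refine hG'.norm_le (fun ζ hζ => ?_) (Real.sqrt_nonneg _)
    have hζd := hζ.comp_deform hκ s
    have e1 : ∫ x, v' x * ζ (x, 0) =
        ∫ z in halfPlane, inner ℝ (G z) (grad (fun z => ζ (deform κ s z)) z) := by
      rw [hvv fun x => ζ (x, 0), hG.2 _ hζd]
      simp_rw [deform_trace]
    set J : ℝ × ℝ → ℝ := fun z => (fderiv ℝ (deform κ s) z).det with hJ
    have hJ0 : ∀ z, 0 ≤ J z := fun z => det_fderiv_deform_nonneg hM hs
    have hJc : Continuous J := by
      have : Continuous (fderiv ℝ (deform κ s)) :=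
        (contDiff_deform κ s).continuous_fderiv (by simp)
      exact ContinuousLinearMap.continuous_det.comp this
    have hgc : Continuous fun z => grad ζ (deform κ s z) :=
      hζ.continuous_grad.comp (contDiff_deform κ s).continuous
    have hdet : ∫ z in halfPlane, J z * ‖grad ζ (deform κ s z)‖ ^ 2 =
        ∫ z in deform κ s '' halfPlane, ‖grad ζ z‖ ^ 2 := by
      rw [integral_image_eq_integral_abs_det_fderiv_smul volume measurableSet_halfPlane
        (fun z _ => (hasFDerivAt_deform κ s z).hasFDerivWithinAt) hinj.injOn]
      refine integral_congr_ae (.of_forall fun z => ?_)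
      simp only [smul_eq_mul]
      rw [abs_of_nonneg (hJ0 z)]
    have hgi : IntegrableOn (fun z => ‖grad ζ z‖ ^ 2) halfPlane := hζ.memLp_grad.integrable_norm_pow
      two_ne_zero
    have hsub : deform κ s '' halfPlane ⊆ halfPlane := by
      rintro _ ⟨z, hz, rfl⟩
      exact deform_mem_halfPlane hM hs hz
    have hJi : Integrable (fun z => J z * ‖grad ζ (deform κ s z)‖ ^ 2)
        (volume.restrict halfPlane) := by
      have h1 := (integrableOn_image_iff_integrableOn_abs_det_fderiv_smul volume
        measurableSet_halfPlane (fun z _ => (hasFDerivAt_deform κ s z).hasFDerivWithinAt)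
        hinj.injOn (fun z => ‖grad ζ z‖ ^ 2)).1 (hgi.mono_set hsub)
      refine h1.congr (.of_forall fun z => ?_)
      simp only [smul_eq_mul]
      rw [abs_of_nonneg (hJ0 z)]
    have hN : ‖gradField ζ hζ‖ ^ 2 = ∫ z in halfPlane, ‖grad ζ z‖ ^ 2 := by
      rw [norm_sq_eq_integral]
      apply integral_congr_ae
      filter_upwards [coeFn_gradField hζ] with z hz
      rw [hz]
    have hJN : ∫ z in halfPlane, J z * ‖grad ζ (deform κ s z)‖ ^ 2 ≤ ‖gradField ζ hζ‖ ^ 2 := by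
      rw [hdet, hN]
      exact setIntegral_mono_set hgi (.of_forall fun z => sq_nonneg _) hsub.eventuallyLE
    -- Cauchy–Schwarz with the weights `k` and `J`
    set a : ℝ × ℝ → ℝ := fun z => √(k z) * ‖G z‖ with ha
    set b : ℝ × ℝ → ℝ := fun z => √(J z) * ‖grad ζ (deform κ s z)‖ with hb
    have ha2 : ∀ z, a z ^ 2 = k z * ‖G z‖ ^ 2 := fun z => by
      rw [ha, mul_pow, Real.sq_sqrt (hk0 z)]
    have hb2 : ∀ z, b z ^ 2 = J z * ‖grad ζ (deform κ s z)‖ ^ 2 := fun z => by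
      rw [hb, mul_pow, Real.sq_sqrt (hJ0 z)]
    have ham : MemLp a 2 (volume.restrict halfPlane) := by
      rw [memLp_two_iff_integrable_sq]
      · simpa only [ha2] using hikG
      · exact (hkm.sqrt.aestronglyMeasurable).mul (Lp.aestronglyMeasurable G).norm
    have hbm : MemLp b 2 (volume.restrict halfPlane) := by
      rw [memLp_two_iff_integrable_sq]
      · simpa only [hb2] using hJi
      · exact (hJc.sqrt.mul hgc.norm).aestronglyMeasurable
    have hpt : ∀ z, inner ℝ (G z) (grad (fun z => ζ (deform κ s z)) z) ≤ a z * b z := by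
      intro z
      have h1 := norm_grad_comp_deform_sq_le (κ := κ) (z := z) hM hs hζ
      have h2 : ‖grad (fun z => ζ (deform κ s z)) z‖ ≤ √(k z) * b z := by
        apply le_of_sq_le_sq _ (by positivity)
        rw [mul_pow, Real.sq_sqrt (hk0 z), hb2]
        exact h1
      calc _ ≤ ‖G z‖ * ‖grad (fun z => ζ (deform κ s z)) z‖ := real_inner_le_norm _ _
        _ ≤ ‖G z‖ * (√(k z) * b z) := by gcongr
        _ = _ := by rw [ha]; ring
    have hint : Integrable (fun z => inner ℝ (G z) (grad (fun z => ζ (deform κ s z)) z))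
        (volume.restrict halfPlane) := by
      refine (L2.integrable_inner (𝕜 := ℝ) G (gradField _ hζd)).congr ?_
      filter_upwards [coeFn_gradField hζd] with z hz
      rw [hz]
    rw [e1]
    refine (integral_mono hint (ham.integrable_mul hbm) hpt).trans ?_
    have h3 := sq_integral_mul_le ham hbm
    simp only [ha2, hb2] at h3
    apply le_of_sq_le_sq _ (by positivity)
    rw [mul_pow, Real.sq_sqrt hI0]
    refine h3.trans ?_
    gcongr
  calc ‖G'‖ ^ 2 ≤ √I ^ 2 := pow_le_pow_left₀ (norm_nonneg _) key 2
    _ = I := Real.sq_sqrt hI0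

/-! ### The Pohozaev identity -/

/-- The defect of the Pohozaev identity, localized by the derivative of the dilation field: up to
sign, the derivative of the exchange and anisotropy energies under the inner variation. -/
def pohozaevDefect (h κ : ℝ) (φ p : ℝ → ℝ) : ℝ :=
  (1 / 2) * (∫ x, p x ^ 2 * dilationDeriv κ x) -
    ∫ x, anisotropy h (Circle.exp (φ x)) * dilationDeriv κ x

theorem integrable_mul_dilationDeriv {f : ℝ → ℝ} (hf : Integrable f) (κ : ℝ) :
    Integrable fun x => f x * dilationDeriv κ x := by
  obtain ⟨M, -, hM⟩ := exists_cutoff_bound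
  exact hf.mul_bdd (c := 1 + M) (continuous_dilationDeriv κ).aestronglyMeasurable
    (.of_forall fun x => abs_dilationDeriv_le hM κ x)

theorem inv_one_add_le {t b : ℝ} (ht : |t| ≤ b) (hb : b ≤ 1 / 2) :
    (1 + t)⁻¹ ≤ 1 - t + 2 * b ^ 2 := by
  have h1 := abs_le.1 ht
  have h2 : t ^ 2 ≤ b ^ 2 := sq_le_sq' h1.1 h1.2
  rw [inv_le_iff_one_le_mul₀ (by linarith)]
  nlinarith [sq_nonneg b, sq_nonneg t]

/-- Comparison of the two computations of the energy of `φ ∘ θ`, where `θ` is the inverse of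
`Ψ = id + s X`. Changing variables bounds the energy from above by means of `pohozaevDefect` and
`tailEnergy`; regarding `φ ∘ θ - φ` as a variation of the phase, whose first variation vanishes,
bounds it from below. The term `½ Q`, with `Q = ∫ (φ ∘ θ - φ)'²`, serves to absorb `S`. -/
theorem IsConfig.defect_le {h : ℝ} {φ p : ℝ → ℝ} {G : L2Field} {m : ℝ → Circle}
    (hc : IsConfig h φ p G) (hm : ∀ᵐ x, m x = Circle.exp (φ x)) (hcrit : IsCritical h m)
    {κ A M s c : ℝ} (hκ : 0 < κ) (hA : 0 < A) (hκA : 2 ≤ κ * A ^ 2)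
    (hM : ∀ τ, |2 * τ * deriv cutoff τ| ≤ M) (hs : |s| * (1 + M) ≤ 1 / 2)
    (hinj : Function.Injective (deform κ s)) (hsc : |s| * A = c) :
    ∃ Q S : ℝ, 0 ≤ Q ∧
      (∀ δ > 0, S ^ 2 ≤ ‖G‖ ^ 2 * ((1 / δ) * (2 * c ^ 3 * (∫ x, p x ^ 2) ^ 2) +
        δ * (2 * c ^ 2 * (∫ x, p x ^ 2) ^ 3 + 2 * c * (∫ x, p x ^ 2) * Q))) ∧
      s * pohozaevDefect h κ φ p ≤ s ^ 2 * (1 + M) ^ 2 * (∫ x, p x ^ 2) +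
        M * |s| * tailEnergy κ G + 2 * (2 + |h|) * c ^ 2 * (∫ x, p x ^ 2) - S - (1 / 2) * Q := by
  have hM0 : 0 ≤ M := (abs_nonneg _).trans (hM 0)
  have hc0 : 0 ≤ c := hsc ▸ by positivity
  set Ψ : ℝ → ℝ := fun x => x + s * dilation κ x with hΨ
  set D : ℝ → ℝ := fun x => 1 + s * dilationDeriv κ x with hD
  have hsd : ∀ x, |s * dilationDeriv κ x| ≤ |s| * (1 + M) := fun x => by
    rw [abs_mul]
    exact mul_le_mul_of_nonneg_left (abs_dilationDeriv_le hM κ x) (abs_nonneg s)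
  obtain ⟨θ, hθ⟩ := exists_isDiffeo (Ψ := Ψ) (D := D) (A := A)
    (fun x => (hasDerivAt_id x).add ((hasDerivAt_dilation κ x).const_mul s))
    (fun x => by have := (abs_le.1 (hsd x)).1; simp only [hD]; linarith)
    (continuous_const.add (continuous_const.mul (continuous_dilationDeriv κ)))
    (fun x hx => by simp [hΨ, dilation_eq_zero_of_lt_abs hκ hA.le hκA hx])
  have hvar := hθ.isVariation hc.prim hc.memLp
  obtain ⟨hb1, hb2⟩ := hθ.variation_bounds hc.prim hc.memLp hc0 (fun x => by
    simp only [hΨ, add_sub_cancel_left, abs_mul, ← hsc]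
    exact mul_le_mul_of_nonneg_left (abs_dilation_le hκ hA.le hκA x) (abs_nonneg s))
  set P := ∫ x, p x ^ 2 with hP
  have hP0 : 0 ≤ P := integral_nonneg fun x => sq_nonneg _
  have hB2 : √(c * P) ^ 2 = c * P := Real.sq_sqrt (by positivity)
  obtain ⟨G', R, Dr, S, hc', hexp, hR, hDr, -, hS⟩ := hc.expansion hvar (B := √(c * P))
    (fun x => Real.abs_le_sqrt (hb1 x))
  rw [hc.firstVariation_eq_zero hm hcrit hvar] at hexp
  set Q := ∫ x, ((D (θ x))⁻¹ * p (θ x) - p x) ^ 2 with hQ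
  set Y := ∫ x, (φ (θ x) - φ x) ^ 2 with hY
  have hQ0 : 0 ≤ Q := integral_nonneg fun x => sq_nonneg _
  have hG' : ‖G'‖ ^ 2 ≤ ‖G‖ ^ 2 + 2 * M * |s| * tailEnergy κ G := by
    refine hc.neumann.norm_sq_le_of_deform hκ hM hs hinj hc'.neumann fun ζ => ?_
    rw [hθ.integral_eq]
    refine integral_congr_ae (.of_forall fun x => ?_)
    simp only [hθ.left_inv, add_sub_cancel]
    rw [show x + s * dilation κ x = Ψ x from rfl]
    have := (hθ.pos x).ne'
    field_simp
  have hPi := hc.memLp.integrable_sq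
  have hex : ∫ x, (p x + ((D (θ x))⁻¹ * p (θ x) - p x)) ^ 2 ≤
      P - s * (∫ x, p x ^ 2 * dilationDeriv κ x) + 2 * (|s| * (1 + M)) ^ 2 * P := by
    rw [hθ.integral_eq]
    have e : ∀ x, D x * (p (Ψ x) + ((D (θ (Ψ x)))⁻¹ * p (θ (Ψ x)) - p (Ψ x))) ^ 2 =
        (D x)⁻¹ * p x ^ 2 := fun x => by
      rw [hθ.left_inv, add_sub_cancel]
      have := (hθ.pos x).ne'
      field_simp
    simp only [e]
    have hid := (integrable_mul_dilationDeriv hPi κ).const_mul s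
    have hi2 := hPi.const_mul (2 * (|s| * (1 + M)) ^ 2)
    calc ∫ x, (D x)⁻¹ * p x ^ 2
        ≤ ∫ x, (p x ^ 2 - s * (p x ^ 2 * dilationDeriv κ x) +
            2 * (|s| * (1 + M)) ^ 2 * p x ^ 2) := by
          refine integral_mono_of_nonneg (.of_forall fun x => ?_) ((hPi.sub hid).add hi2)
            (.of_forall fun x => ?_)
          · exact mul_nonneg (inv_pos.2 (hθ.pos x)).le (sq_nonneg _)
          · have := mul_le_mul_of_nonneg_right (inv_one_add_le (hsd x) hs) (sq_nonneg (p x))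
            simp only [hD]
            linarith
      _ = _ := by
          have h3 := integral_add (hPi.sub hid) hi2
          simp only [Pi.sub_apply] at h3
          rw [h3, integral_sub hPi hid, integral_const_mul, integral_const_mul]
  have han : ∫ x, anisotropy h (Circle.exp (φ x + (φ (θ x) - φ x))) =
      (∫ x, anisotropy h (Circle.exp (φ x))) +
        s * ∫ x, anisotropy h (Circle.exp (φ x)) * dilationDeriv κ x := by
    have hid := (integrable_mul_dilationDeriv hc.integrable κ).const_mul s
    rw [hθ.integral_eq, ← integral_const_mul, ← integral_add hc.integrable hid]
    refine integral_congr_ae (.of_forall fun x => ?_)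
    simp only [hθ.left_inv, add_sub_cancel, hD]
    ring
  rw [han] at hexp
  refine ⟨Q, S, hQ0, fun δ hδ => (hS δ hδ).trans ?_, ?_⟩
  · have h4 : √(c * P) ^ 4 = (c * P) ^ 2 := by
      rw [show √(c * P) ^ 4 = (√(c * P) ^ 2) ^ 2 by ring, hB2]
    rw [h4, hB2]
    gcongr ‖G‖ ^ 2 * (1 / δ * ?_ + δ * ?_)
    · calc c * P * Y ≤ c * P * (2 * c ^ 2 * P) := by gcongr
        _ = _ := by ring
    · exact le_of_eq (by ring)
  · have hR' := (abs_le.1 hR).1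
    have hRY : (2 + |h|) * Y ≤ (2 + |h|) * (2 * c ^ 2 * P) :=
      mul_le_mul_of_nonneg_left hb2 (by positivity)
    have hs2 : (|s| * (1 + M)) ^ 2 = s ^ 2 * (1 + M) ^ 2 := by rw [mul_pow, sq_abs]
    rw [hs2] at hex
    unfold pohozaevDefect
    linarith

/-- At fixed `κ`, taking `|s| A = τ ^ 4` and the interpolation parameter `δ = τ ^ 2` in
`IsConfig.defect_le` makes all error terms other than the tail `O(τ ^ 5)`, hence of higher order
than `s`. -/
theorem IsConfig.abs_defect_le {h : ℝ} {φ p : ℝ → ℝ} {G : L2Field} {m : ℝ → Circle}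
    (hc : IsConfig h φ p G) (hm : ∀ᵐ x, m x = Circle.exp (φ x)) (hcrit : IsCritical h m)
    {κ M : ℝ} (hκ : 0 < κ) (hM : ∀ τ, |2 * τ * deriv cutoff τ| ≤ M) :
    |pohozaevDefect h κ φ p| ≤ M * tailEnergy κ G := by
  have hM0 : 0 ≤ M := (abs_nonneg _).trans (hM 0)
  obtain ⟨s₀, hs₀, hinj⟩ := exists_deform_injective hκ
  set A := √(2 / κ) with hAdef
  have hA : 0 < A := Real.sqrt_pos.2 (by positivity)
  have hκA : 2 ≤ κ * A ^ 2 := by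
    rw [hAdef, Real.sq_sqrt (by positivity)]
    field_simp
    exact le_rfl
  set P := ∫ x, p x ^ 2 with hP
  have hP0 : 0 ≤ P := integral_nonneg fun x => sq_nonneg _
  set g := ‖G‖ ^ 2 with hg
  have hg0 : 0 ≤ g := sq_nonneg _
  set J := pohozaevDefect h κ φ p with hJ
  set T := tailEnergy κ G with hT
  set K := 1 / 2 + g * (P ^ 2 + P ^ 3) with hK
  have hbound : ∀ τ : ℝ, 0 < τ → τ ^ 4 / A * (1 + M) ≤ 1 / 2 → τ ^ 4 / A ≤ s₀ →
      g * P * τ ≤ 1 / 2 →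
      |J| ≤ M * T + τ ^ 4 / A * (1 + M) ^ 2 * P + A * (2 * (2 + |h|) * τ ^ 4 * P + K * τ) := by
    intro τ hτ h1 h2 h3
    set a := τ ^ 4 / A with ha
    have ha0 : 0 < a := by positivity
    have haA : a * A = τ ^ 4 := by rw [ha]; field_simp
    have hside : ∀ s : ℝ, |s| = a → s * J ≤
        a * (M * T + a * (1 + M) ^ 2 * P + A * (2 * (2 + |h|) * τ ^ 4 * P + K * τ)) := by
      intro s hsa
      obtain ⟨Q, S, hQ, hS, hle⟩ := hc.defect_le hm hcrit hκ hA hκA hM (s := s) (c := τ ^ 4)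
        (by rw [hsa]; exact h1) (hinj s (by rw [hsa]; exact h2)) (by rw [hsa, haA])
      -- Young's inequality with weight `τ ^ 5`, after which `½ Q` absorbs the part containing `Q`
      have hS' := hS (τ ^ 2) (by positivity)
      have e1 : g * ((1 / τ ^ 2) * (2 * (τ ^ 4) ^ 3 * P ^ 2) +
          τ ^ 2 * (2 * (τ ^ 4) ^ 2 * P ^ 3 + 2 * τ ^ 4 * P * Q)) =
          τ ^ 5 * (2 * g * (P ^ 2 + P ^ 3) * τ ^ 5 + 2 * (g * P * τ) * Q) := by
        field_simp
        ring
      rw [e1] at hS'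
      have hSy : -S ≤ (1 / 2) * (2 * g * (P ^ 2 + P ^ 3) * τ ^ 5 + 2 * (g * P * τ) * Q) +
          (1 / 2) * τ ^ 5 := by
        have h5 : 0 < τ ^ 5 := by positivity
        have h6 : 0 ≤ τ ^ 5 * ((2 * g * (P ^ 2 + P ^ 3) * τ ^ 5 + 2 * (g * P * τ) * Q) +
            τ ^ 5 + 2 * S) := by nlinarith [sq_nonneg (S + τ ^ 5)]
        have := nonneg_of_mul_nonneg_right h6 h5
        linarith
      have hQ3 : g * P * τ * Q ≤ 1 / 2 * Q := mul_le_mul_of_nonneg_right h3 hQ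
      have hs2 : s ^ 2 = a * a := by rw [← sq_abs, hsa, sq]
      rw [hsa, hs2] at hle
      have e2 : a * (M * T + a * (1 + M) ^ 2 * P + A * (2 * (2 + |h|) * τ ^ 4 * P + K * τ)) =
          a * M * T + a * a * (1 + M) ^ 2 * P + (a * A) * (2 * (2 + |h|) * τ ^ 4 * P + K * τ) := by
        ring
      rw [e2, haA]
      have e3 : τ ^ 4 * (2 * (2 + |h|) * τ ^ 4 * P + K * τ) =
          2 * (2 + |h|) * (τ ^ 4) ^ 2 * P + (1 / 2) * τ ^ 5 + g * (P ^ 2 + P ^ 3) * τ ^ 5 := by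
        rw [hK]; ring
      rw [e3]
      linarith
    have hp := hside a (abs_of_pos ha0)
    have hn := hside (-a) (by rw [abs_neg, abs_of_pos ha0])
    rw [abs_le]
    constructor
    · rw [neg_mul_comm] at hn
      linarith [le_of_mul_le_mul_left hn ha0]
    · exact le_of_mul_le_mul_left hp ha0
  have hlim : Tendsto (fun τ : ℝ => M * T + τ ^ 4 / A * (1 + M) ^ 2 * P +
      A * (2 * (2 + |h|) * τ ^ 4 * P + K * τ)) (𝓝[>] 0) (𝓝 (M * T)) := by
    have : Continuous fun τ : ℝ => M * T + τ ^ 4 / A * (1 + M) ^ 2 * P +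
      A * (2 * (2 + |h|) * τ ^ 4 * P + K * τ) := by fun_prop
    have h0 := (this.tendsto 0).mono_left (nhdsWithin_le_nhds (s := Ioi 0))
    simpa using h0
  have hsmall : ∀ (f : ℝ → ℝ), Continuous f → f 0 = 0 → ∀ ε > 0, ∀ᶠ τ in 𝓝[>] (0 : ℝ), f τ ≤ ε := by
    intro f hf hf0 ε hε
    have h0 := (hf.tendsto 0).mono_left (nhdsWithin_le_nhds (s := Ioi 0))
    rw [hf0] at h0
    exact (h0.eventually (gt_mem_nhds hε)).mono fun _ => le_of_lt
  refine ge_of_tendsto hlim ?_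
  filter_upwards [self_mem_nhdsWithin,
    hsmall (fun τ => τ ^ 4 / A * (1 + M)) (by fun_prop) (by simp) (1 / 2) (by norm_num),
    hsmall (fun τ => τ ^ 4 / A) (by fun_prop) (by simp) s₀ hs₀,
    hsmall (fun τ => g * P * τ) (by fun_prop) (by simp) (1 / 2) (by norm_num)] with τ h0 h1 h2 h3
  exact hbound τ h0 h1 h2 h3

theorem tendsto_integral_mul_dilationDeriv {f : ℝ → ℝ} (hf : Integrable f) {κ : ℕ → ℝ}
    (hκ : Tendsto κ atTop (𝓝 0)) :
    Tendsto (fun n => ∫ x, f x * dilationDeriv (κ n) x) atTop (𝓝 (∫ x, f x)) := by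
  obtain ⟨M, -, hM⟩ := exists_cutoff_bound
  refine tendsto_integral_of_dominated_convergence (fun x => ‖f x‖ * (1 + M))
    (fun n => (integrable_mul_dilationDeriv hf _).aestronglyMeasurable) (hf.norm.mul_const _)
    (fun n => .of_forall fun x => ?_) (.of_forall fun x => ?_)
  · rw [norm_mul]
    exact mul_le_mul_of_nonneg_left (abs_dilationDeriv_le hM _ x) (norm_nonneg _)
  · have h0 : Tendsto (fun n => κ n * x ^ 2) atTop (𝓝 0) := by simpa using hκ.mul_const (x ^ 2)
    refine tendsto_const_nhds.congr' ?_
    filter_upwards [h0.eventually (gt_mem_nhds one_pos)] with n hn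
    rw [dilationDeriv_eq_one hn, mul_one]

theorem tendsto_tailEnergy (G : L2Field) {κ : ℕ → ℝ} (hκ : Tendsto κ atTop (𝓝 0)) :
    Tendsto (fun n => tailEnergy (κ n) G) atTop (𝓝 0) := by
  have := tendsto_integral_of_dominated_convergence (μ := volume.restrict halfPlane)
    (F := fun n z => {z : ℝ × ℝ | 1 ≤ κ n * (z.1 ^ 2 + z.2 ^ 2)}.indicator
      (fun z => ‖G z‖ ^ 2) z) (f := fun _ => 0) (fun z => ‖G z‖ ^ 2)
    (fun n => ((integrable_norm_sq G).indicator (measurableSet_tail _)).aestronglyMeasurable)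
    (integrable_norm_sq G)
    (fun n => .of_forall fun z => (norm_indicator_le_norm_self _ _).trans (by simp))
    (.of_forall fun z => ?_)
  · simpa [tailEnergy] using this
  · have h0 : Tendsto (fun n => κ n * (z.1 ^ 2 + z.2 ^ 2)) atTop (𝓝 0) := by
      simpa using hκ.mul_const (z.1 ^ 2 + z.2 ^ 2)
    refine tendsto_const_nhds.congr' ?_
    filter_upwards [h0.eventually (gt_mem_nhds one_pos)] with n hn
    rw [indicator_of_notMem]
    exact not_le.2 hn

theorem IsConfig.pohozaev {h : ℝ} {φ p : ℝ → ℝ} {G : L2Field} {m : ℝ → Circle}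
    (hc : IsConfig h φ p G) (hm : ∀ᵐ x, m x = Circle.exp (φ x)) (hcrit : IsCritical h m) :
    ∫ x, p x ^ 2 = 2 * ∫ x, anisotropy h (Circle.exp (φ x)) := by
  obtain ⟨M, hM0, hM⟩ := exists_cutoff_bound
  have hκ := tendsto_one_div_add_atTop_nhds_zero_nat (𝕜 := ℝ)
  have h1 : Tendsto (fun n : ℕ => pohozaevDefect h (1 / ((n : ℝ) + 1)) φ p) atTop
      (𝓝 ((1 / 2) * (∫ x, p x ^ 2) - ∫ x, anisotropy h (Circle.exp (φ x)))) :=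
    ((tendsto_integral_mul_dilationDeriv hc.memLp.integrable_sq hκ).const_mul _).sub
      (tendsto_integral_mul_dilationDeriv hc.integrable hκ)
  have h2 : Tendsto (fun n : ℕ => pohozaevDefect h (1 / ((n : ℝ) + 1)) φ p) atTop (𝓝 0) := by
    have h3 := (tendsto_tailEnergy G hκ).const_mul M
    rw [mul_zero] at h3
    refine squeeze_zero_norm (fun n => ?_) h3
    exact hc.abs_defect_le hm hcrit Nat.one_div_pos_of_nat hM
  have := tendsto_nhds_unique h1 h2
  linarith

end NeelWall

end

theorem proposition1p4 (h : ℝ) (hh0 : 0 ≤ h) (hh1 : h ≠ 1) (m : ℝ → Circle)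
    (hm : NeelWall.MemH1loc m) (hE : NeelWall.energy h m < ⊤)
    (hcrit : NeelWall.IsCritical h m) :
    MeasureTheory.Integrable (fun x => ‖NeelWall.weakDeriv m x‖ ^ 2) ∧
      MeasureTheory.Integrable (fun x => NeelWall.anisotropy h (m x)) ∧
      ∫ x, ‖NeelWall.weakDeriv m x‖ ^ 2 = 2 * ∫ x, NeelWall.anisotropy h (m x) := by
  obtain ⟨g, hg, -⟩ := hm
  obtain ⟨φ, p, hφ, hmφ⟩ := NeelWall.exists_phase hg
  obtain ⟨G, hc⟩ := NeelWall.exists_isConfig hφ hmφ hE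
  have hd := NeelWall.norm_weakDeriv_sq_ae_eq hφ hmφ
  have ha : (fun x => NeelWall.anisotropy h (m x)) =ᵐ[MeasureTheory.MeasureSpace.volume]
      fun x => NeelWall.anisotropy h (Circle.exp (φ x)) := by
    filter_upwards [hmφ] with x hx
    rw [hx]
  refine ⟨hc.memLp.integrable_sq.congr hd.symm, hc.integrable.congr ha.symm, ?_⟩
  rw [MeasureTheory.integral_congr_ae hd, MeasureTheory.integral_congr_ae ha]
  exact hc.pohozaev hmφ hcrit
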